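/- Let $p$ be a prime. For a commutative ring $R$, let $W(R)$ be the ring of $p$-typical Witt vectors of $R$, let $W_{p^n}(R)$ be its truncation to the first $n+1$ components, and let $F:W(R)\to W(R)$ and $F:W_{p^{n}}(R)\to W_{p^{n-1}}(R)$ be the Witt vector Frobenius homomorphisms. For $r\in R$ let $[r]=(r,0,0,\dots)\in W(R)$ be the Teichmüller element. Define ideals of $R$ by $I_0=R$, $I_i=\{r\in R: r^p\in pI_{i-1}\}$ for $i\ge 1$, and put $I_\infty=\bigcap_i I_i$. Let $R$ be one of the following rings: the ring $\mathbb{Z}[\mu_{p^\infty}]$ generated by all roots of unity of $p$-power order in $\mathbb{C}$; the ring $\mathbb{Z}_p[\mu_{p^\infty}]$ generated over $\mathbb{Z}_p$ by all roots of unity of $p$-power order in an algebraic closure of $\mathbb{Q}_p$; or the $p$-adic completion of $\mathbb{Z}_p[\mu_{p^\infty}]$. Then: 1. $F:W_{p^n}(R)\to W_{p^{n-1}}(R)$ is surjective for every $n\ge 2$. 2. The image of $F:W(R)\to W(R)$ does not contain all Teichmüller elements $[r]$, $r\in R$. 3. The $p$-th power map on $R/pI_\infty$ is not surjective. More precisely: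 - if $p>2$, then there is no $x\in R$ with $x^p\equiv 1-p \pmod{pI_\infty}$; - if $p=2$, then for every primitive $4$th root of unity $i\in R$ and every primitive $8$th root of unity $\zeta\in R$ there is no $x\in R$ with $x^2\equiv i+2\zeta \pmod{2I_\infty}$. -/

import Mathlib

noncomputable section

/-! ### Frobenius on Witt vectors of finite length -/

section TruncatedFrobenius

variable (p : ℕ) [hp : Fact p.Prime] (n : ℕ) (R : Type*) [CommRing R]

/-- The `i`-th component of `F x` involves only the components `x_0, …, x_{i+1}` of `x`. -/
theorem frobeniusPoly_vars_subset (i : ℕ) :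
    (WittVector.frobeniusPoly p i).vars ⊆ Finset.range (i + 2) := by
  classical
  have h : (WittVector.frobeniusPolyRat p i).vars ⊆ Finset.range (i + 2) := by
    unfold WittVector.frobeniusPolyRat
    refine (MvPolynomial.vars_bind₁ _ _).trans ?_
    intro k hk
    rw [Finset.mem_biUnion] at hk
    obtain ⟨j, hj, hkj⟩ := hk
    have h1 := xInTermsOfW_vars_subset p i hj
    have h2 := wittPolynomial_vars_subset p ℚ (j + 1) hkj
    rw [Finset.mem_range] at h1 h2 ⊢
    omega
  rw [← WittVector.map_frobeniusPoly p i,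
    MvPolynomial.vars_map_of_injective _ (Int.cast_injective)] at h
  exact h

theorem truncate_frobenius_of_mem_ker (x : WittVector p R)
    (hx : WittVector.truncate (n + 1) x = 0) :
    WittVector.truncate n (WittVector.frobenius x) = 0 := by
  have hx' := (WittVector.mem_ker_truncate (n + 1) x).mp hx
  refine (WittVector.mem_ker_truncate n _).mpr fun i hi => ?_
  have h0 : (WittVector.frobenius (0 : WittVector p R)).coeff i = 0 := by simp
  rw [WittVector.coeff_frobenius] at h0 ⊢
  rw [← h0]
  refine MvPolynomial.eval₂Hom_congr' rfl (fun j hj _ => ?_) rfl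
  have := Finset.mem_range.mp (frobeniusPoly_vars_subset p i hj)
  rw [hx' j (by omega), WittVector.zero_coeff]

/-- The Frobenius homomorphism from Witt vectors with `n + 1` components to Witt vectors with
`n` components. It is the map induced by the Frobenius of `W(R)`; see
`truncatedFrobenius_truncate`. -/
def truncatedFrobenius :
    TruncatedWittVector p (n + 1) R →+* TruncatedWittVector p n R :=
  (WittVector.truncate (p := p) (R := R) (n + 1)).liftOfRightInverse
    TruncatedWittVector.out (fun x => TruncatedWittVector.truncateFun_out x)
    ⟨(WittVector.truncate n).comp WittVector.frobenius,
      fun x hx => truncate_frobenius_of_mem_ker p n R x hx⟩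

theorem truncatedFrobenius_truncate (x : WittVector p R) :
    truncatedFrobenius p n R (WittVector.truncate (n + 1) x) =
      WittVector.truncate n (WittVector.frobenius x) :=
  RingHom.liftOfRightInverse_comp_apply _ _ _ _ x

end TruncatedFrobenius

/-! ### The ideals `I_i` and `I_∞` -/

section Ideals

variable (p : ℕ) (R : Type*) [CommRing R]

/-- The sets `I_0 = R`, `I_{i+1} = {r | r ^ p ∈ p I_i}`. -/
def ISet : ℕ → Set R
  | 0 => Set.univ
  | i + 1 => {r | ∃ s ∈ ISet i, r ^ p = p * s}

theorem ISet_succ_subset (i : ℕ) : ISet p R (i + 1) ⊆ ISet p R i := by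
  induction i with
  | zero => exact fun _ _ => trivial
  | succ i ih =>
    rintro r ⟨s, hs, h⟩
    exact ⟨s, ih hs, h⟩

theorem ISet_smul (i : ℕ) (c : R) {x : R} (hx : x ∈ ISet p R i) :
    c * x ∈ ISet p R i := by
  induction i generalizing c x with
  | zero => trivial
  | succ i ih =>
    obtain ⟨s, hs, h⟩ := hx
    exact ⟨c ^ p * s, ih _ hs, by rw [mul_pow, h]; ring⟩

theorem ISet_zero_mem (hp : p.Prime) (i : ℕ) : (0 : R) ∈ ISet p R i := by
  induction i with
  | zero => trivial
  | succ i ih => exact ⟨0, ih, by simp [hp.ne_zero]⟩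

theorem ISet_add (hp : p.Prime) (i : ℕ) {x y : R} (hx : x ∈ ISet p R i) (hy : y ∈ ISet p R i) :
    x + y ∈ ISet p R i := by
  induction i generalizing x y with
  | zero => trivial
  | succ i ih =>
    have hx0 := ISet_succ_subset p R i hx
    obtain ⟨s, hs, h⟩ := hx
    obtain ⟨t, ht, h'⟩ := hy
    obtain ⟨r, hr⟩ := exists_add_pow_prime_eq hp x y
    refine ⟨s + t + (y * r) * x, ih (ih hs ht) (ISet_smul p R i _ hx0), ?_⟩
    rw [hr, h, h']
    ring

variable [hp : Fact p.Prime]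

/-- The ideal `I_i` of `R`. -/
def IIdeal (i : ℕ) : Ideal R where
  carrier := ISet p R i
  add_mem' := ISet_add p R hp.out i
  zero_mem' := ISet_zero_mem p R hp.out i
  smul_mem' c _ hx := ISet_smul p R i c hx

/-- The ideal `I_∞`, the intersection of all `I_i`. -/
def IInfty : Ideal R := ⨅ i : ℕ, IIdeal p R i

/-- The ideal `p I_∞`. -/
def pIInfty : Ideal R := Ideal.span {(p : R)} * IInfty p R

end Ideals

/-! ### Conditions on a ring -/

section Conditions

variable (p : ℕ) [hp : Fact p.Prime] (R : Type*) [CommRing R]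

/-- `F : W_{p^n}(R) → W_{p^{n-1}}(R)` is surjective for all `n ≥ 2`. Elements of `W_{p^n}(R)` have
`n + 1` components. -/
def FrobeniusSurjectiveFiniteLevels : Prop :=
  ∀ n : ℕ, 2 ≤ n → Function.Surjective (truncatedFrobenius p n R)

/-- The image of `F : W(R) → W(R)` contains all Teichmüller elements. -/
def TeichmullerInFrobeniusImage : Prop :=
  ∀ r : R, ∃ x : WittVector p R, WittVector.frobenius x = WittVector.teichmuller p r

/-- The `p`-th power map on `R / p I_∞` is surjective. -/
def PthPowerSurjectiveModPIInfty : Prop :=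
  Function.Surjective (fun x : R ⧸ pIInfty p R => x ^ p)

end Conditions

/-- For an `A`-algebra `K` which is a field, the subalgebra `A[μ_{p^∞}]` of `K` generated by all
roots of unity of `p`-power order in `K`. -/
def adjoinMuPInfty (p : ℕ) (A K : Type*) [CommRing A] [Field K] [Algebra A K] : Subalgebra A K :=
  Algebra.adjoin A {ζ : K | ∃ n : ℕ, ζ ^ p ^ n = 1}

/-- The ring `ℤ[μ_{p^∞}]`. -/
abbrev ZMuPInfty (p : ℕ) : Type := adjoinMuPInfty p ℤ ℂ

/-- The ring `ℤ_p[μ_{p^∞}]`. -/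
abbrev ZpMuPInfty (p : ℕ) [Fact p.Prime] : Type :=
  adjoinMuPInfty p ℤ_[p] (AlgebraicClosure ℚ_[p])

/-- The `p`-adic completion of `ℤ_p[μ_{p^∞}]`. -/
abbrev ZpMuPInftyCompletion (p : ℕ) [Fact p.Prime] : Type :=
  AdicCompletion (Ideal.span {(p : ZpMuPInfty p)}) (ZpMuPInfty p)

end

/-!
Let `ζ` be a primitive `p ^ (n + 1)`-th root of unity. Comparing ghost components gives
`V^n(1) = ∑ [ζ^(p i)]`, summed over `i < p ^ n`, so `V^n(1) = F(∑ [ζ^i])`. As `F` maps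
`[s] * ∑ [ζ^i]` to `V^n([s^(p^(n+1))])`, and `V^(n+1) [t]` to `V^n(p [t])`, surjectivity of the
`p`-th power map modulo `p` lets one correct `y - F x` one component at a time.

Conversely, `F x = [r]` forces `x_j ∈ I_∞` for all `j ≥ 1`, whence `r ≡ x_0 ^ p` modulo `p I_∞`,
and an element of `I_∞` has at least the valuation of `p ^ (1 / (p - 1))`. Every element of
`ℤ_p[μ_{p^∞}]` is a polynomial in `λ = ζ - 1` for `ζ` of sufficiently large order, and a
congruence between such polynomials modulo a divisor `λ ^ j` of `p` is a congruence modulo `X ^ j`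
in `𝔽_p[X]`. A `p`-th root of `1 - p` (or of `i + 2 ζ` when `p = 2`) modulo `p I_∞` would in this
way solve an Artin–Schreier equation `w ^ p - w = a` over `𝔽_p(X)` modulo elements integral at `X`.
Since `t ^ p ^ n ≡ t` modulo the values of `w ^ p - w`, the pole of `a` can be reduced to order `1`
(respectively `3`), which is prime to `p`, whereas `w ^ p - w` has poles of order divisible by `p`.
-/

/-! ### Teichmüller representatives and the Witt vector Frobenius -/

section Teichmuller

open WittVector Finset

variable {p : ℕ} [hp : Fact p.Prime] {R : Type*} [CommRing R]

theorem coeff_frobenius_eq (x : WittVector p R) (n : ℕ) :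
    (frobenius x).coeff n =
      x.coeff n ^ p + p * MvPolynomial.aeval x.coeff (frobeniusPolyAux p n) := by
  simp [coeff_frobenius, frobeniusPoly]

theorem aeval_teichmuller_coeff_frobeniusPolyAux (r : R) (n : ℕ) :
    MvPolynomial.aeval (teichmuller p r).coeff (frobeniusPolyAux p n) = 0 := by
  induction n using Nat.strong_induction_on with
  | _ n ih =>
    rw [frobeniusPolyAux_eq, map_sub, MvPolynomial.aeval_X,
      teichmuller_coeff_pos _ _ _ n.succ_pos, zero_sub, neg_eq_zero, map_sum]
    refine sum_eq_zero fun i hi => ?_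
    simp [ih i (mem_range.mp hi)]

theorem frobenius_teichmuller (r : R) :
    frobenius (teichmuller p r) = teichmuller p (r ^ p) := by
  ext n
  rw [coeff_frobenius_eq, aeval_teichmuller_coeff_frobeniusPolyAux, mul_zero, add_zero]
  rcases n.eq_zero_or_pos with rfl | hn
  · rw [teichmuller_coeff_zero, teichmuller_coeff_zero]
  · rw [teichmuller_coeff_pos _ _ _ hn, teichmuller_coeff_pos _ _ _ hn, zero_pow hp.out.ne_zero]

theorem iterate_frobenius_teichmuller (r : R) (n : ℕ) :
    frobenius^[n] (teichmuller p r) = teichmuller p (r ^ p ^ n) := by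
  induction n with
  | zero => simp
  | succ n ih => rw [Function.iterate_succ_apply', ih, frobenius_teichmuller, ← pow_mul, pow_succ]

theorem ghostMap_injective (hpR : IsLeftRegular (p : R)) :
    Function.Injective (ghostMap : WittVector p R → ℕ → R) := by
  intro x y hxy
  ext n
  induction n using Nat.strong_induction_on with
  | _ n ih =>
    have hn := congrFun hxy n
    simp only [ghostMap_apply, ghostComponent_apply, aeval_wittPolynomial, sum_range_succ,
      Nat.sub_self, pow_zero, pow_one] at hn
    rw [sum_congr rfl fun i hi => by rw [ih i (mem_range.mp hi)], add_right_inj] at hn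
    exact hpR.pow n hn

theorem ghostComponent_iterate_verschiebung_one (n j : ℕ) :
    ghostComponent j (verschiebung^[n] (1 : WittVector p R)) =
      if j < n then 0 else (p : R) ^ n := by
  induction n generalizing j with
  | zero => simp
  | succ n ih =>
    rw [Function.iterate_succ_apply']
    cases j with
    | zero => simp [ghostComponent_zero_verschiebung]
    | succ j =>
      rw [ghostComponent_verschiebung, ih, mul_ite, mul_zero, ← pow_succ']
      simp only [Nat.add_lt_add_iff_right]

theorem sum_pow_pow_eq_ite [IsDomain R] {ζ : R} {n : ℕ} (hζ : IsPrimitiveRoot ζ (p ^ n))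
    (j : ℕ) : ∑ i ∈ range (p ^ n), (ζ ^ i) ^ p ^ j = if j < n then 0 else (p : R) ^ n := by
  simp_rw [← pow_mul, mul_comm _ (p ^ j), pow_mul]
  split_ifs with hjn
  · have hne : ζ ^ p ^ j ≠ 1 :=
      hζ.pow_ne_one_of_pos_of_lt (pow_ne_zero _ hp.out.ne_zero)
        (Nat.pow_lt_pow_right hp.out.one_lt hjn)
    refine (mul_eq_zero.mp ?_).resolve_left (sub_ne_zero.mpr hne)
    rw [mul_geom_sum, ← pow_mul, mul_comm, pow_mul, hζ.pow_eq_one, one_pow, sub_self]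
  · have hone : ζ ^ p ^ j = 1 := (hζ.pow_eq_one_iff_dvd _).mpr (pow_dvd_pow p (not_lt.mp hjn))
    simp [hone]

theorem sum_teichmuller_pow [IsDomain R] [CharZero R] {ζ : R} {n : ℕ}
    (hζ : IsPrimitiveRoot ζ (p ^ n)) :
    ∑ i ∈ range (p ^ n), teichmuller p (ζ ^ i) = verschiebung^[n] 1 := by
  refine ghostMap_injective (IsLeftCancelMulZero.mul_left_cancel_of_ne_zero
    (Nat.cast_ne_zero.mpr hp.out.ne_zero)) (funext fun j => ?_)
  simp only [ghostMap_apply, map_sum, ghostComponent_teichmuller,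
    ghostComponent_iterate_verschiebung_one, sum_pow_pow_eq_ite hζ]

theorem exists_frobenius_eq_iterate_verschiebung_one [IsDomain R] [CharZero R] {ζ : R} {n : ℕ}
    (hζ : IsPrimitiveRoot ζ (p ^ (n + 1))) :
    ∃ x : WittVector p R, frobenius x = verschiebung^[n] 1 := by
  have hζp : IsPrimitiveRoot (ζ ^ p) (p ^ n) :=
    hζ.pow (pow_pos hp.out.pos _) (pow_succ' p n)
  refine ⟨∑ i ∈ range (p ^ n), teichmuller p (ζ ^ i), ?_⟩
  rw [map_sum, ← sum_teichmuller_pow hζp]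
  exact sum_congr rfl fun i _ => by rw [frobenius_teichmuller, pow_right_comm]

end Teichmuller

/-! ### Surjectivity of the Frobenius at finite levels -/

/-- The `p`-th power map on `R / pR` is surjective. -/
def PthPowerSurjectiveModP (p : ℕ) (R : Type*) [CommRing R] : Prop :=
  ∀ r : R, ∃ s : R, (p : R) ∣ r - s ^ p

section SurjectiveFiniteLevels

open WittVector

variable {p : ℕ} {R : Type*} [CommRing R]

theorem PthPowerSurjectiveModP.exists_dvd_sub_pow_pow (h : PthPowerSurjectiveModP p R) (n : ℕ)
    (r : R) : ∃ s : R, (p : R) ∣ r - s ^ p ^ n := by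
  induction n with
  | zero => exact ⟨r, by simp⟩
  | succ n ih =>
    obtain ⟨s, hs⟩ := ih
    obtain ⟨t, ht⟩ := h s
    have hst : (p : R) ∣ s ^ p ^ n - t ^ p ^ (n + 1) := by
      rw [pow_succ', pow_mul]
      exact ht.trans (sub_dvd_pow_sub_pow _ _ _)
    exact ⟨t, by simpa using dvd_add hs hst⟩

theorem PthPowerSurjectiveModP.of_forall_exists_dvd_sub_map {S : Type*} [CommRing S]
    {f : R →+* S} (hf : ∀ b : S, ∃ a : R, (p : S) ∣ b - f a) (hR : PthPowerSurjectiveModP p R) :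
    PthPowerSurjectiveModP p S := by
  intro b
  obtain ⟨a, ha⟩ := hf b
  obtain ⟨s, hs⟩ := hR a
  have hfs : (p : S) ∣ f a - f s ^ p := by simpa using map_dvd f hs
  exact ⟨f s, by simpa using dvd_add ha hfs⟩

variable [hp : Fact p.Prime]

theorem exists_iterate_verschiebung_sub_frobenius_eq (h : PthPowerSurjectiveModP p R) {n : ℕ}
    {g : WittVector p R} (hg : frobenius g = verschiebung^[n] 1) (w : WittVector p R) :
    ∃ u w' : WittVector p R, verschiebung^[n] w - frobenius u = verschiebung^[n + 1] w' := by
  obtain ⟨s, t, hst⟩ := h.exists_dvd_sub_pow_pow (n + 1) (w.coeff 0)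
  set z := w - (teichmuller p (s ^ p ^ (n + 1)) + teichmuller p t * (p : WittVector p R)) with hz
  have hz0 : z.coeff 0 = 0 := by
    rw [← constantCoeff_apply, hz, map_sub, map_add, map_mul, map_natCast]
    simp only [constantCoeff_apply, teichmuller_coeff_zero]
    linear_combination hst
  have hu : frobenius (teichmuller p s * g + verschiebung^[n + 1] (teichmuller p t)) =
      verschiebung^[n]
        (teichmuller p (s ^ p ^ (n + 1)) + teichmuller p t * (p : WittVector p R)) := by
    rw [map_add, map_mul, hg, mul_comm, iterate_verschiebung_mul_left, one_mul,
      ← Function.iterate_succ_apply, iterate_frobenius_teichmuller, iterate_map_add,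
      Function.iterate_succ_apply', frobenius_verschiebung, iterate_verschiebung_mul_left,
      Function.iterate_fixed (map_natCast (WittVector.frobenius (R := R)) p)]
  refine ⟨teichmuller p s * g + verschiebung^[n + 1] (teichmuller p t), z.shift 1, ?_⟩
  rw [hu, ← iterate_map_sub, ← hz, Function.iterate_succ_apply]
  exact congrArg _ (eq_iterate_verschiebung (n := 1) fun i hi => by rwa [Nat.lt_one_iff.mp hi])

theorem exists_sub_frobenius_eq_iterate_verschiebung (h : PthPowerSurjectiveModP p R)
    (hg : ∀ n, ∃ g : WittVector p R, frobenius g = verschiebung^[n] 1) (y : WittVector p R)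
    (n : ℕ) : ∃ x w : WittVector p R, y - frobenius x = verschiebung^[n] w := by
  induction n with
  | zero => exact ⟨0, y, by simp⟩
  | succ n ih =>
    obtain ⟨x, w, hxw⟩ := ih
    obtain ⟨g, hgn⟩ := hg n
    obtain ⟨u, w', huw'⟩ := exists_iterate_verschiebung_sub_frobenius_eq h hgn w
    exact ⟨x + u, w', by rw [map_add, ← sub_sub, hxw, huw']⟩

theorem truncatedFrobenius_surjective [IsDomain R] [CharZero R]
    (hζ : ∀ n, ∃ ζ : R, IsPrimitiveRoot ζ (p ^ n)) (h : PthPowerSurjectiveModP p R) (n : ℕ) :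
    Function.Surjective (truncatedFrobenius p n R) := by
  intro y
  obtain ⟨y, rfl⟩ := truncate_surjective p n R y
  obtain ⟨x, w, hxw⟩ := exists_sub_frobenius_eq_iterate_verschiebung h
    (fun m => (hζ (m + 1)).elim fun _ => exists_frobenius_eq_iterate_verschiebung_one) y n
  refine ⟨truncate (n + 1) x, ?_⟩
  rw [truncatedFrobenius_truncate, eq_comm, ← sub_eq_zero, ← map_sub, hxw]
  exact (mem_ker_truncate n _).mpr fun i => iterate_verschiebung_coeff_eq_zero w

end SurjectiveFiniteLevels

/-! ### The ideals `I_i` -/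

section IIdeal

variable {p : ℕ} [hp : Fact p.Prime] {R : Type*} [CommRing R]

theorem mem_IIdeal_succ {i : ℕ} {r : R} :
    r ∈ IIdeal p R (i + 1) ↔ ∃ s ∈ IIdeal p R i, r ^ p = p * s := Iff.rfl

theorem mem_IInfty {r : R} : r ∈ IInfty p R ↔ ∀ i, r ∈ IIdeal p R i := by
  simp [IInfty]

theorem mem_pIInfty {r : R} : r ∈ pIInfty p R ↔ ∃ s ∈ IInfty p R, p * s = r :=
  Ideal.mem_span_singleton_mul

theorem natCast_mem_IInfty : (p : R) ∈ IInfty p R := by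
  refine mem_IInfty.mpr fun i => ?_
  induction i with
  | zero => trivial
  | succ i ih =>
    refine mem_IIdeal_succ.mpr
      ⟨_, Ideal.pow_mem_of_mem _ ih (p - 1) (Nat.sub_pos_of_lt hp.out.one_lt), ?_⟩
    rw [mul_pow_sub_one hp.out.ne_zero]

theorem pow_dvd_mul_pow_of_mem_IIdeal {i : ℕ} {s : R} (hs : s ∈ IIdeal p R i) :
    (p : R) ^ p ^ i ∣ p * s ^ (p ^ i * (p - 1)) := by
  induction i generalizing s with
  | zero => simp
  | succ i ih =>
    obtain ⟨t, ht, hst⟩ := mem_IIdeal_succ.mp hs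
    have hexp : p ^ (i + 1) = p ^ i * (p - 1) + p ^ i := by
      rw [← Nat.mul_succ, Nat.succ_eq_add_one, Nat.sub_add_cancel hp.out.one_le, pow_succ]
    rw [pow_succ' p i, mul_assoc, pow_mul s, hst, mul_pow, ← pow_succ', hexp, pow_add,
      mul_left_comm]
    exact mul_dvd_mul_left _ (ih ht)

theorem valuation_pow_le_of_mem_IInfty {v : Valuation R NNReal} (hv : ∀ x, v x ≤ 1)
    (hvp : v p ≠ 0) {s : R} (hs : s ∈ IInfty p R) : v s ^ (p - 1) ≤ v p := by
  by_contra! hlt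
  obtain ⟨i, hi⟩ := pow_unbounded_of_one_lt (v p)⁻¹ ((one_lt_div (pos_of_ne_zero hvp)).mpr hlt)
  obtain ⟨t, ht⟩ := pow_dvd_mul_pow_of_mem_IIdeal (mem_IInfty.mp hs i)
  have hle : v p * (v s ^ (p - 1)) ^ p ^ i ≤ v p ^ p ^ i := by
    rw [← pow_mul, mul_comm (p - 1), ← map_pow, ← map_mul, ht, map_mul, map_pow]
    exact mul_le_of_le_one_right' (hv t)
  have hlt' : (v p)⁻¹ < (v s ^ (p - 1) / v p) ^ p ^ i :=
    hi.trans_le (pow_le_pow_right₀ ((one_lt_div (pos_of_ne_zero hvp)).mpr hlt).le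
      (Nat.lt_pow_self hp.out.one_lt).le)
  rw [div_pow, lt_div_iff₀ (pow_pos (pos_of_ne_zero hvp) _), inv_mul_lt_iff₀ (pos_of_ne_zero hvp)]
    at hlt'
  exact hlt'.not_ge hle

end IIdeal

section PthPowers

open WittVector

variable {p : ℕ} [hp : Fact p.Prime] {R : Type*} [CommRing R]

theorem aeval_sub_aeval_mem {σ : Type*} {I : Ideal R} {x y : σ → R} (h : ∀ i, x i - y i ∈ I)
    (P : MvPolynomial σ ℤ) : MvPolynomial.aeval x P - MvPolynomial.aeval y P ∈ I := by
  rw [← Ideal.Quotient.eq, ← Ideal.Quotient.mkₐ_eq_mk ℤ, ← AlgHom.comp_apply,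
    ← AlgHom.comp_apply, MvPolynomial.comp_aeval, MvPolynomial.comp_aeval]
  exact congrArg (MvPolynomial.aeval · P) (funext fun i => Ideal.Quotient.eq.mpr (h i))

theorem coeff_succ_mem_IIdeal {x : WittVector p R} {r : R} (hx : frobenius x = teichmuller p r)
    (i n : ℕ) : x.coeff (n + 1) ∈ IIdeal p R i := by
  induction i generalizing n with
  | zero => trivial
  | succ i ih =>
    have hcoeff : x.coeff (n + 1) ^ p +
        p * MvPolynomial.aeval x.coeff (frobeniusPolyAux p (n + 1)) = 0 := by
      rw [← coeff_frobenius_eq, hx, teichmuller_coeff_pos _ _ _ n.succ_pos]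
    have hcongr : ∀ j, x.coeff j - (teichmuller p (x.coeff 0)).coeff j ∈ IIdeal p R i
      | 0 => by simp
      | j + 1 => by simpa [teichmuller_coeff_pos _ _ _ j.succ_pos] using ih j
    have haeval := aeval_sub_aeval_mem hcongr (frobeniusPolyAux p (n + 1))
    rw [aeval_teichmuller_coeff_frobeniusPolyAux, sub_zero] at haeval
    exact mem_IIdeal_succ.mpr ⟨_, neg_mem haeval, by linear_combination hcoeff⟩

variable (p R) in
/-- The class of `c` is a `p`-th power in `R / p I_∞`. -/
def IsPthPowerModPIInfty (c : R) : Prop :=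
  ∃ x : R, x ^ p - c ∈ pIInfty p R

theorem TeichmullerInFrobeniusImage.isPthPowerModPIInfty (h : TeichmullerInFrobeniusImage p R)
    (r : R) : IsPthPowerModPIInfty p R r := by
  obtain ⟨x, hx⟩ := h r
  refine ⟨x.coeff 0, mem_pIInfty.mpr
    ⟨-x.coeff 1, neg_mem (mem_IInfty.mpr fun i => coeff_succ_mem_IIdeal hx i 0), ?_⟩⟩
  have hcoeff := coeff_frobenius_eq x 0
  rw [hx, teichmuller_coeff_zero, frobeniusPolyAux_eq, Finset.sum_range_zero, sub_zero,
    MvPolynomial.aeval_X] at hcoeff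
  linear_combination hcoeff

theorem PthPowerSurjectiveModPIInfty.isPthPowerModPIInfty (h : PthPowerSurjectiveModPIInfty p R)
    (r : R) : IsPthPowerModPIInfty p R r := by
  obtain ⟨x, hx⟩ := h (Ideal.Quotient.mk _ r)
  obtain ⟨x, rfl⟩ := Ideal.Quotient.mk_surjective x
  exact ⟨x, Ideal.Quotient.eq.mp (by simpa using hx)⟩

variable {S : Type*} [CommRing S] (f : R →+* S)

theorem map_mem_IIdeal {i : ℕ} {r : R} (hr : r ∈ IIdeal p R i) : f r ∈ IIdeal p S i := by
  induction i generalizing r with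
  | zero => trivial
  | succ i ih =>
    obtain ⟨s, hs, hrs⟩ := mem_IIdeal_succ.mp hr
    exact mem_IIdeal_succ.mpr ⟨f s, ih hs, by rw [← map_pow, hrs, map_mul, map_natCast]⟩

theorem IsPthPowerModPIInfty.map {c : R} (h : IsPthPowerModPIInfty p R c) :
    IsPthPowerModPIInfty p S (f c) := by
  obtain ⟨x, hx⟩ := h
  obtain ⟨s, hs, hsx⟩ := mem_pIInfty.mp hx
  refine ⟨f x, mem_pIInfty.mpr
    ⟨f s, mem_IInfty.mpr fun i => map_mem_IIdeal f (mem_IInfty.mp hs i), ?_⟩⟩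
  rw [← map_pow, ← map_sub, ← hsx, map_mul, map_natCast]

variable {f} (hpS : IsLeftRegular (p : S)) (hdvd : ∀ r, (p : S) ∣ f r → (p : R) ∣ r)
include hpS hdvd

theorem mem_IIdeal_of_map_mem {i : ℕ} {r : R} (hr : f r ∈ IIdeal p S i) : r ∈ IIdeal p R i := by
  induction i generalizing r with
  | zero => trivial
  | succ i ih =>
    obtain ⟨s, hs, hrs⟩ := mem_IIdeal_succ.mp hr
    obtain ⟨t, hrt⟩ := hdvd (r ^ p) ⟨s, by rw [map_pow, hrs]⟩
    have hts : f t = s := hpS <| show (p : S) * f t = p * s by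
      rw [← hrs, ← map_pow, hrt, map_mul, map_natCast]
    exact mem_IIdeal_succ.mpr ⟨t, ih (hts ▸ hs), hrt⟩

theorem IsPthPowerModPIInfty.of_map (hf : ∀ b : S, ∃ a : R, (p : S) ∣ b - f a) {c : R}
    (h : IsPthPowerModPIInfty p S (f c)) : IsPthPowerModPIInfty p R c := by
  obtain ⟨x, hx⟩ := h
  obtain ⟨s, hs, hsx⟩ := mem_pIInfty.mp hx
  obtain ⟨a, ha⟩ := hf x
  obtain ⟨y, hy⟩ := dvd_sub_pow_of_dvd_sub ha 1
  rw [pow_one] at hy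
  have hfac : f (a ^ p - c) = p * (s - p * y) := by
    rw [map_sub, map_pow]
    linear_combination -hsx - hy
  obtain ⟨t, ht⟩ := hdvd _ ⟨_, hfac⟩
  have hft : f t = s - p * y := hpS <| show (p : S) * f t = p * (s - p * y) by
    rw [← hfac, ht, map_mul, map_natCast]
  refine ⟨a, mem_pIInfty.mpr ⟨t, mem_IInfty.mpr fun i => ?_, ht.symm⟩⟩
  refine mem_IIdeal_of_map_mem hpS hdvd ?_
  rw [hft]
  exact mem_IInfty.mp (sub_mem hs (Ideal.mul_mem_right _ _ natCast_mem_IInfty)) i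

end PthPowers

/-! ### Artin–Schreier equations over a valued field of characteristic `p` -/

section ArtinSchreier

open WithZero

theorem valuation_eq_pow_of_valuation_pow_sub_self_sub_le_one {K Γ₀ : Type*} [Ring K]
    [LinearOrderedCommGroupWithZero Γ₀] {v : Valuation K Γ₀} {n : ℕ} (hn : 1 < n) {w a : K}
    (hw : v (w ^ n - w - a) ≤ 1) (ha : 1 < v a) : v a = v w ^ n := by
  have hva : v (w ^ n - w) = v a := by
    rw [← v.map_add_eq_of_lt_right (hw.trans_lt ha), sub_add_cancel]
  have hvw : 1 < v w := by
    by_contra! hle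
    exact ha.not_ge (hva ▸ v.map_sub_le (by simpa using pow_le_one' hle n) hle)
  rw [← hva, v.map_sub_eq_of_lt_left (by simpa using lt_self_pow₀ hvw hn), map_pow]

section Subgroup

variable (p : ℕ) [hp : Fact p.Prime] {K Γ₀ : Type*} [Field K] [CharP K p]
  [LinearOrderedCommGroupWithZero Γ₀] (v : Valuation K Γ₀)

/-- The additive subgroup `℘(K) + 𝒪` of a valued field `K` of characteristic `p`, where
`℘(w) = w ^ p - w` and `𝒪` is the valuation ring: the `a` for which the Artin–Schreier equation
`℘(w) = a` is solvable modulo `𝒪`. -/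
def artinSchreierSubgroup : AddSubgroup K :=
  ((frobenius K p : K →+ K) - AddMonoidHom.id K).range ⊔ v.integer.toAddSubgroup

variable {p v}

theorem mem_artinSchreierSubgroup {a : K} :
    a ∈ artinSchreierSubgroup p v ↔ ∃ w, v (w ^ p - w - a) ≤ 1 := by
  simp only [artinSchreierSubgroup, AddSubgroup.mem_sup, AddMonoidHom.mem_range,
    AddMonoidHom.sub_apply, AddMonoidHom.id_apply, AddMonoidHom.coe_coe, frobenius_def]
  constructor
  · rintro ⟨_, ⟨w, rfl⟩, b, hb, rfl⟩
    exact ⟨w, by rw [sub_add_cancel_left, v.map_neg]; exact hb⟩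
  · rintro ⟨w, hw⟩
    exact ⟨_, ⟨w, rfl⟩, _, neg_mem (show w ^ p - w - a ∈ v.integer from hw), by ring⟩

theorem pow_pow_sub_self_mem_artinSchreierSubgroup (t : K) (n : ℕ) :
    t ^ p ^ n - t ∈ artinSchreierSubgroup p v := by
  induction n with
  | zero => simp
  | succ n ih =>
    have hstep : t ^ p ^ (n + 1) - t ^ p ^ n ∈ artinSchreierSubgroup p v :=
      mem_artinSchreierSubgroup.mpr ⟨t ^ p ^ n, by rw [pow_succ, pow_mul]; simp⟩
    simpa using add_mem hstep ih

end Subgroup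

variable {p : ℕ} [hp : Fact p.Prime] {K : Type*} [Field K] [CharP K p] {v : Valuation K ℤᵐ⁰}

theorem dvd_log_valuation_of_mem_artinSchreierSubgroup {a : K}
    (ha : a ∈ artinSchreierSubgroup p v) (hva : 1 < v a) : (p : ℤ) ∣ log (v a) := by
  obtain ⟨w, hw⟩ := mem_artinSchreierSubgroup.mp ha
  rw [valuation_eq_pow_of_valuation_pow_sub_self_sub_le_one hp.out.one_lt hw hva, log_pow,
    nsmul_eq_mul]
  exact dvd_mul_right _ _

section Uniformizer

variable {x : K} (hx : v x = exp (-1))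
include hx

theorem valuation_inv_pow_eq_exp (m : ℕ) : v (x⁻¹ ^ m) = exp (m : ℤ) := by
  rw [map_pow, map_inv₀, hx, ← exp_neg, ← exp_nsmul, neg_neg, nsmul_one]

theorem valuation_pow_lt_valuation_artinSchreier (n : ℕ) (h : K) :
    v x ^ p ^ (n + 1) < v (h ^ p - x ^ ((p - 1) * p ^ n) * h - 1) := by
  have hx0 : x ≠ 0 := v.ne_zero_iff.mp (hx ▸ exp_ne_zero)
  by_contra! hle
  have hmem : x⁻¹ ^ p ^ (n + 1) ∈ artinSchreierSubgroup p v := by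
    refine mem_artinSchreierSubgroup.mpr ⟨h / x ^ p ^ n, ?_⟩
    have hexp : p ^ (n + 1) = (p - 1) * p ^ n + p ^ n := by
      rw [← Nat.succ_mul, Nat.succ_eq_add_one, Nat.sub_add_cancel hp.out.one_le, pow_succ']
    have hlin : x ^ ((p - 1) * p ^ n) * h / x ^ p ^ (n + 1) = h / x ^ p ^ n := by
      rw [hexp, pow_add, mul_div_mul_left _ _ (pow_ne_zero _ hx0)]
    have hdiv : (h / x ^ p ^ n) ^ p - h / x ^ p ^ n - x⁻¹ ^ p ^ (n + 1) =
        (h ^ p - x ^ ((p - 1) * p ^ n) * h - 1) / x ^ p ^ (n + 1) := by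
      rw [sub_div, sub_div, hlin, div_pow, ← pow_mul, ← pow_succ, inv_pow, one_div]
    rw [hdiv, map_div₀, map_pow]
    exact div_le_one_of_le₀ hle zero_le
  have hmem' : x⁻¹ ∈ artinSchreierSubgroup p v := by
    simpa using sub_mem hmem (pow_pow_sub_self_mem_artinSchreierSubgroup x⁻¹ (n + 1))
  have hv : v x⁻¹ = exp 1 := by simpa using valuation_inv_pow_eq_exp hx 1
  have hdvd := dvd_log_valuation_of_mem_artinSchreierSubgroup hmem'
    (by rw [hv, ← exp_zero, exp_lt_exp]; exact one_pos)
  rw [hv, log_exp] at hdvd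
  exact hp.out.one_lt.not_ge (by exact_mod_cast Int.le_of_dvd one_pos hdvd)

theorem pow_three_add_mem_artinSchreierSubgroup [CharP K 2] {a : ℕ} {h : K}
    (hle : v ((1 + x ^ 2 ^ (a + 2)) * h ^ 2 + x ^ 2 ^ (a + 2) * h - 1 - x ^ 2 ^ (a + 1)) ≤
      v x ^ 2 ^ (a + 3)) :
    x⁻¹ ^ 3 + 3 * x⁻¹ ∈ artinSchreierSubgroup 2 v := by
  have hx0 : x ≠ 0 := v.ne_zero_iff.mp (hx ▸ exp_ne_zero)
  have hx1 : v x ≤ 1 := by rw [hx, ← exp_zero, exp_le_exp]; decide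
  have two_eq_zero : (2 : K) = 0 := CharTwo.two_eq_zero
  set y := x ^ 2 ^ (a + 1) with hy
  have hy2 : x ^ 2 ^ (a + 2) = y ^ 2 := by rw [hy, ← pow_mul, ← pow_succ]
  have hy4 : x ^ 2 ^ (a + 3) = y ^ 4 := by rw [hy, ← pow_mul]; ring
  have hy0 : y ≠ 0 := pow_ne_zero _ hx0
  rw [← map_pow, hy4, hy2] at hle
  have hmem : y⁻¹ ^ 4 + y⁻¹ ^ 3 + y⁻¹ ^ 2 + y⁻¹ ∈ artinSchreierSubgroup 2 v := by
    refine mem_artinSchreierSubgroup.mpr ⟨(1 + y ^ 2) * h / y ^ 2, ?_⟩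
    have hdiv : ((1 + y ^ 2) * h / y ^ 2) ^ 2 - (1 + y ^ 2) * h / y ^ 2 -
        (y⁻¹ ^ 4 + y⁻¹ ^ 3 + y⁻¹ ^ 2 + y⁻¹) =
        (1 + y ^ 2) * (((1 + y ^ 2) * h ^ 2 + y ^ 2 * h - 1 - y) / y ^ 4) := by
      field_simp
      linear_combination (-(1 + y ^ 2) * h * y ^ 2) * two_eq_zero
    rw [hdiv, map_mul, map_div₀]
    refine mul_le_one' (v.map_add_le v.map_one.le ?_) (div_le_one_of_le₀ hle zero_le)
    rw [hy, ← pow_mul, map_pow]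
    exact pow_le_one' hx1 _
  have hfrob (t : K) (n : ℕ) := pow_pow_sub_self_mem_artinSchreierSubgroup (p := 2) (v := v) t n
  have hsub := add_mem (add_mem (hfrob x⁻¹ (a + 3)) (hfrob (x⁻¹ ^ 3) (a + 1)))
    (add_mem (hfrob x⁻¹ (a + 2)) (hfrob x⁻¹ (a + 1)))
  convert sub_mem hmem hsub using 1
  rw [pow_right_comm]
  simp only [inv_pow, hy4, hy2, ← hy]
  ring

theorem valuation_pow_lt_valuation_artinSchreier_two [CharP K 2] (a : ℕ) (h : K) :
    v x ^ 2 ^ (a + 3) <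
      v ((1 + x ^ 2 ^ (a + 2)) * h ^ 2 + x ^ 2 ^ (a + 2) * h - 1 - x ^ 2 ^ (a + 1)) := by
  by_contra! hle
  have hmem := pow_three_add_mem_artinSchreierSubgroup hx hle
  have hv : v (x⁻¹ ^ 3 + 3 * x⁻¹) = exp 3 := by
    have h3 : (3 : K) = 1 := by linear_combination (CharTwo.two_eq_zero : (2 : K) = 0)
    have hv1 : v x⁻¹ = exp 1 := by simpa using valuation_inv_pow_eq_exp hx 1
    have hv3 : v (x⁻¹ ^ 3) = exp 3 := valuation_inv_pow_eq_exp hx 3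
    rw [h3, one_mul, v.map_add_eq_of_lt_left, hv3]
    rw [hv1, hv3, exp_lt_exp]
    decide
  have hdvd := dvd_log_valuation_of_mem_artinSchreierSubgroup hmem
    (by rw [hv, ← exp_zero, exp_lt_exp]; decide)
  rw [hv, log_exp] at hdvd
  revert hdvd
  decide

end Uniformizer

section Polynomial

open Polynomial IsDedekindDomain.HeightOneSpectrum

theorem valuation_idealX_le_of_X_pow_dvd {k : Type*} [Field k] {n : ℕ} {f : k[X]}
    (hf : X ^ n ∣ f) :
    (idealX k).valuation (RatFunc k) (algebraMap k[X] _ f) ≤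
      (idealX k).valuation (RatFunc k) RatFunc.X ^ n := by
  obtain ⟨g, rfl⟩ := hf
  rw [map_mul, map_mul, map_pow, map_pow, RatFunc.algebraMap_X]
  exact mul_le_of_le_one_right' (valuation_le_one _ g)

theorem not_X_pow_dvd_artinSchreier (n : ℕ) (h : (ZMod p)[X]) :
    ¬ X ^ p ^ (n + 1) ∣ h ^ p - X ^ ((p - 1) * p ^ n) * h - 1 := fun hdvd =>
  (valuation_pow_lt_valuation_artinSchreier (p := p) (valuation_X_eq_neg_one (ZMod p)) n
    (algebraMap (ZMod p)[X] _ h)).not_ge (by simpa using valuation_idealX_le_of_X_pow_dvd hdvd)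

theorem not_X_pow_dvd_artinSchreier_two (a : ℕ) (h : (ZMod 2)[X]) :
    ¬ X ^ 2 ^ (a + 3) ∣
      (1 + X ^ 2 ^ (a + 2)) * h ^ 2 + X ^ 2 ^ (a + 2) * h - 1 - X ^ 2 ^ (a + 1) := fun hdvd =>
  (valuation_pow_lt_valuation_artinSchreier_two (valuation_X_eq_neg_one (ZMod 2)) a
    (algebraMap (ZMod 2)[X] _ h)).not_ge (by simpa using valuation_idealX_le_of_X_pow_dvd hdvd)

end Polynomial

end ArtinSchreier

/-! ### Congruences in rings containing roots of unity -/

section Congruences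

variable {p : ℕ} [hp : Fact p.Prime] {S : Type*} [CommRing S]

theorem natCast_mul_sq_dvd_one_add_pow_sub (w : S) :
    (p : S) * w ^ 2 ∣ (1 + w) ^ p - (1 + p * w + w ^ p) := by
  obtain ⟨m, hm⟩ := Nat.exists_eq_add_of_le' hp.out.two_le
  have hsum : (1 + w) ^ p - (1 + p * w + w ^ p) =
      ∑ k ∈ Finset.range m, w ^ (k + 2) * (p.choose (k + 2) : S) := by
    simp only [add_comm 1 w, add_pow, one_pow, mul_one]
    rw [Finset.sum_range_succ, hm, Finset.sum_range_succ', Finset.sum_range_succ']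
    simp
    ring
  rw [hsum]
  refine Finset.dvd_sum fun k hk => ?_
  rw [Finset.mem_range] at hk
  rw [mul_comm (p : S)]
  exact mul_dvd_mul (pow_dvd_pow w le_add_self)
    (Nat.cast_dvd_cast (hp.out.dvd_choose_self (Nat.succ_ne_zero _) (by omega)))

theorem sub_mul_dvd_pow_sub_pow {a b : S} (hab : a ∣ b) {n : ℕ} (hn : 2 ≤ n) :
    (b - a) * a ∣ b ^ n - a ^ n := by
  obtain ⟨u, rfl⟩ := hab
  obtain ⟨m, rfl⟩ := Nat.exists_eq_add_of_le' hn
  obtain ⟨c, hc⟩ := sub_dvd_pow_sub_pow u 1 (m + 2)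
  rw [one_pow] at hc
  exact ⟨a ^ m * c, by linear_combination a ^ (m + 2) * hc⟩

theorem natCast_mul_dvd_one_add_pow_sub_add {M τ : S} (hMp : M ∣ (p : S))
    (hMτ : M ∣ τ ^ 2) (hτ : p * M ∣ τ ^ p + p) (K r : S) :
    p * M ∣ (1 + (τ * K + p * r)) ^ p - (1 - p) + p * (K ^ p - τ * K - 1) := by
  have hpM : p * M ∣ (p : S) ^ 2 := pow_two (p : S) ▸ mul_dvd_mul_left _ hMp
  obtain ⟨t, ht⟩ := hMτ
  obtain ⟨m, hm⟩ := hMp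
  have hsq : p * M ∣ p * (τ * K + p * r) ^ 2 :=
    mul_dvd_mul_left _ ⟨t * K ^ 2 + 2 * m * τ * K * r + m * p * r ^ 2,
      by linear_combination K ^ 2 * ht + (2 * τ * K * r + p * r ^ 2) * hm⟩
  have hone := hsq.trans (natCast_mul_sq_dvd_one_add_pow_sub (p := p) (τ * K + p * r))
  have hpow : p * M ∣ (τ * K + p * r) ^ p - (τ * K) ^ p := by
    refine hpM.trans ?_
    simpa using dvd_sub_pow_of_dvd_sub (p := p) (a := τ * K + p * r) (b := τ * K) (by simp) 1
  convert dvd_add (dvd_add hone hpow) (dvd_add (hτ.mul_right (K ^ p)) (hpM.mul_right r)) using 1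
  ring

theorem four_dvd_one_add_sq_sub_add {τ ρ : S} (hτ : 4 ∣ τ ^ 2 + 2 * τ + 2) (K r : S) :
    4 ∣ (1 + (τ * K + 2 * r)) ^ 2 - (1 + 2 * (1 + ρ)) +
      2 * ((1 + τ) * K ^ 2 + τ * K - 1 - ρ) := by
  obtain ⟨c, hc⟩ := hτ
  exact ⟨c * K ^ 2 + τ * K * r + r ^ 2 + τ * K + r - 1 - ρ, by linear_combination K ^ 2 * hc⟩

end Congruences

section PrimitiveRoots

variable {p : ℕ} [hp : Fact p.Prime] {O : Type*} [CommRing O]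

theorem natCast_dvd_sub_one_pow_sub (ζ : O) (n : ℕ) :
    (p : O) ∣ ζ ^ p ^ n - 1 - (ζ - 1) ^ p ^ n := by
  obtain ⟨b, hb⟩ := exists_add_pow_prime_pow_eq hp.out (ζ - 1) 1 n
  rw [sub_add_cancel, one_pow] at hb
  exact ⟨(ζ - 1) * b, by linear_combination hb⟩

variable [IsDomain O]

theorem associated_sub_one_pow {ζ : O} {n : ℕ} (hζ : IsPrimitiveRoot ζ (p ^ (n + 1))) :
    Associated ((ζ - 1) ^ (p ^ n * (p - 1))) (p : O) := by
  have hcyc := Polynomial.eval_one_cyclotomic_prime_pow (R := O) (p := p) n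
  rw [Polynomial.cyclotomic_eq_prod_X_sub_primitiveRoots hζ, Polynomial.eval_prod] at hcyc
  rw [← hcyc, ← Nat.totient_prime_pow_succ hp.out, ← hζ.card_primitiveRoots, ← Finset.prod_const]
  refine Associated.prod _ _ _ fun μ hμ => ?_
  rw [mem_primitiveRoots (pow_pos hp.out.pos _)] at hμ
  obtain ⟨i, -, hi, rfl⟩ := hζ.isPrimitiveRoot_iff.mp hμ
  rw [Polynomial.eval_sub, Polynomial.eval_X, Polynomial.eval_C, ← neg_sub (ζ ^ i)]
  exact (hζ.associated_sub_one_pow_sub_one_of_coprime hi).neg_right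

theorem sub_one_pow_prime_pow_dvd {ζ : O} {n : ℕ} (hζ : IsPrimitiveRoot ζ (p ^ (n + 1))) :
    (ζ - 1) ^ p ^ n ∣ (p : O) :=
  (pow_dvd_pow _ (Nat.le_mul_of_pos_right _ (Nat.sub_pos_of_lt hp.out.one_lt))).trans
    (associated_sub_one_pow hζ).dvd

theorem natCast_mul_sub_one_dvd_sub_one_pow_add {ω : O} (hω : IsPrimitiveRoot ω p) :
    p * (ω - 1) ∣ (ω - 1) ^ (p - 1) + p := by
  have h := natCast_mul_sq_dvd_one_add_pow_sub (p := p) (ω - 1)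
  rw [add_sub_cancel, hω.pow_eq_one, ← dvd_neg] at h
  rw [← mul_dvd_mul_iff_left (sub_ne_zero.mpr (hω.ne_one hp.out.one_lt))]
  convert h using 1
  · ring
  · rw [mul_add, ← pow_succ', Nat.sub_add_cancel hp.out.one_le]
    ring

theorem natCast_mul_dvd_sub_one_pow_add (hp2 : p ≠ 2) {ζ : O} {n : ℕ}
    (hζ : IsPrimitiveRoot ζ (p ^ (n + 1))) :
    p * (ζ - 1) ^ p ^ n ∣ (ζ - 1) ^ (p ^ n * (p - 1)) + p := by
  have hp3 : 2 ≤ p - 1 := Nat.le_sub_one_of_lt (hp.out.two_le.lt_of_ne' hp2)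
  have hω : IsPrimitiveRoot (ζ ^ p ^ n) p := hζ.pow (pow_pos hp.out.pos _) (pow_succ p n)
  have hsub := natCast_dvd_sub_one_pow_sub (p := p) ζ n
  have hdvd : (ζ - 1) ^ p ^ n ∣ ζ ^ p ^ n - 1 :=
    (dvd_sub_self_right).mp ((sub_one_pow_prime_pow_dvd hζ).trans hsub)
  have hω' := (mul_dvd_mul_left (p : O) hdvd).trans (natCast_mul_sub_one_dvd_sub_one_pow_add hω)
  have hpow := (mul_dvd_mul_right hsub _).trans (sub_mul_dvd_pow_sub_pow hdvd hp3)
  rw [pow_mul]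
  convert dvd_sub hω' hpow using 1
  ring

theorem sq_pow_eq_neg_one_of_isPrimitiveRoot {ζ : O} {n : ℕ}
    (hζ : IsPrimitiveRoot ζ (2 ^ (n + 2))) : (ζ ^ 2 ^ n) ^ 2 = -1 := by
  rw [← pow_mul, ← pow_succ]
  exact (hζ.pow (by positivity) (pow_succ 2 (n + 1))).eq_neg_one_of_two_right

theorem four_dvd_sub_one_pow_sq_add {ζ : O} {n : ℕ} (hζ : IsPrimitiveRoot ζ (2 ^ (n + 2))) :
    4 ∣ ((ζ - 1) ^ 2 ^ n) ^ 2 + 2 * (ζ - 1) ^ 2 ^ n + 2 := by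
  have hj := sq_pow_eq_neg_one_of_isPrimitiveRoot hζ
  obtain ⟨z, hz⟩ := natCast_dvd_sub_one_pow_sub (p := 2) ζ n
  rw [Nat.cast_ofNat] at hz
  set j := ζ ^ 2 ^ n
  refine ⟨z ^ 2 - j * z, ?_⟩
  linear_combination hj - ((ζ - 1) ^ 2 ^ n + 1 + j - 2 * z) * hz

end PrimitiveRoots

/-! ### Reduction of polynomials in `ζ - 1` modulo `p` -/

section Reduction

open Polynomial

theorem valuation_le_of_dvd {O Γ₀ : Type*} [CommRing O] [LinearOrderedCommMonoidWithZero Γ₀]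
    {v : Valuation O Γ₀} (hv : ∀ x, v x ≤ 1) {x y : O} (h : x ∣ y) : v y ≤ v x := by
  obtain ⟨z, rfl⟩ := h
  rw [map_mul]
  exact mul_le_of_le_one_right' (hv z)

theorem X_pow_dvd_map_of_valuation_aeval_le {A k O Γ₀ : Type*} [CommRing A] [CommRing k]
    [CommRing O] [LinearOrderedCommGroupWithZero Γ₀] [Algebra A O] {φ : A →+* k}
    {v : Valuation O Γ₀} (hv : ∀ x, v x ≤ 1) {lam : O} (h0 : v lam ≠ 0) {d : ℕ}
    (hφ : ∀ a, v (algebraMap A O a) ≤ v lam → φ a = 0 ∧ v (algebraMap A O a) ≤ v lam ^ d)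
    {j : ℕ} (hj : j ≤ d) {f : A[X]} (h : v (aeval lam f) ≤ v lam ^ j) : X ^ j ∣ f.map φ := by
  induction j generalizing f with
  | zero => simp
  | succ j ih =>
    have haeval : aeval lam f = lam * aeval lam f.divX + algebraMap A O (f.coeff 0) := by
      conv_lhs => rw [← f.X_mul_divX_add, map_add, map_mul, aeval_X, aeval_C]
    have hcoeff : v (algebraMap A O (f.coeff 0)) ≤ v lam := by
      rw [← add_sub_cancel_left (lam * aeval lam f.divX) (algebraMap A O _), ← haeval]
      rw [← map_pow] at h
      exact v.map_sub_le (h.trans (valuation_le_of_dvd hv (dvd_pow_self lam j.succ_ne_zero)))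
        (valuation_le_of_dvd hv (dvd_mul_right _ _))
    obtain ⟨hzero, hle⟩ := hφ _ hcoeff
    have hdivX : v lam * v (aeval lam f.divX) ≤ v lam * v lam ^ j := by
      rw [← map_mul, ← pow_succ', ← add_sub_cancel_right (lam * _) (algebraMap A O (f.coeff 0)),
        ← haeval]
      exact v.map_sub_le h (hle.trans (pow_le_pow_right_of_le_one' (hv lam) hj))
    rw [← f.X_mul_divX_add, Polynomial.map_add, Polynomial.map_mul, map_X, map_C, hzero, C_0,
      add_zero, pow_succ']
    exact mul_dvd_mul_left _
      (ih (by omega) ((mul_le_mul_iff_right₀ (zero_lt_iff.mpr h0)).mp hdivX))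

variable {p : ℕ} [hp : Fact p.Prime]

theorem toZMod_eq_zero_iff {c : ℤ_[p]} : PadicInt.toZMod c = 0 ↔ (p : ℤ_[p]) ∣ c := by
  rw [← RingHom.mem_ker, PadicInt.ker_toZMod, PadicInt.maximalIdeal_eq_span_p,
    Ideal.mem_span_singleton]

theorem exists_eq_X_pow_mul_add {j : ℕ} {f : ℤ_[p][X]} (h : X ^ j ∣ f.map PadicInt.toZMod) :
    ∃ k r : ℤ_[p][X], f = X ^ j * k + C (p : ℤ_[p]) * r := by
  obtain ⟨g, hg⟩ := h
  obtain ⟨k, rfl⟩ := Polynomial.map_surjective _ (ZMod.ringHom_surjective PadicInt.toZMod) g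
  have hdvd : C (p : ℤ_[p]) ∣ f - X ^ j * k := by
    rw [C_dvd_iff_dvd_coeff]
    intro i
    rw [← toZMod_eq_zero_iff, ← coeff_map]
    simp [hg]
  obtain ⟨r, hr⟩ := hdvd
  exact ⟨k, r, by rw [← hr]; ring⟩

variable {O Γ₀ : Type*} [CommRing O] [IsDomain O] [LinearOrderedCommGroupWithZero Γ₀]
  {v : Valuation O Γ₀} (hv : ∀ x, v x ≤ 1) {ζ : O} {n : ℕ}

include hv

theorem valuation_sub_one_pow (hζ : IsPrimitiveRoot ζ (p ^ (n + 1))) :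
    v (ζ - 1) ^ (p ^ n * (p - 1)) = v p := by
  rw [← map_pow]
  exact le_antisymm (valuation_le_of_dvd hv (associated_sub_one_pow hζ).dvd')
    (valuation_le_of_dvd hv (associated_sub_one_pow hζ).dvd)

variable [Algebra ℤ_[p] O] (hvp0 : v p ≠ 0) (hvp : v p < 1)

include hvp0 hvp

theorem X_pow_dvd_map_toZMod (hζ : IsPrimitiveRoot ζ (p ^ (n + 1))) {j : ℕ}
    (hj : j ≤ p ^ n * (p - 1)) {f : ℤ_[p][X]} (h : v (aeval (ζ - 1) f) ≤ v (ζ - 1) ^ j) :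
    X ^ j ∣ f.map PadicInt.toZMod := by
  have hpow := valuation_sub_one_pow hv hζ
  have hd : p ^ n * (p - 1) ≠ 0 :=
    mul_ne_zero (pow_ne_zero n hp.out.ne_zero) (Nat.sub_pos_of_lt hp.out.one_lt).ne'
  refine X_pow_dvd_map_of_valuation_aeval_le hv ((pow_ne_zero_iff hd).mp (hpow ▸ hvp0))
    (fun a ha => ?_) hj h
  have hdvd : (p : ℤ_[p]) ∣ a := by
    rw [← PadicInt.norm_lt_one_iff_dvd]
    refine (PadicInt.norm_le_one a).lt_of_ne fun hnorm => hvp.not_ge ?_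
    have hunit := (PadicInt.isUnit_iff.mpr hnorm).map (algebraMap ℤ_[p] O)
    rw [← hpow]
    exact one_le_pow_of_one_le' (v.map_one ▸ (valuation_le_of_dvd hv hunit.dvd).trans ha) _
  refine ⟨toZMod_eq_zero_iff.mpr hdvd, hpow ▸ valuation_le_of_dvd hv ?_⟩
  simpa using map_dvd (algebraMap ℤ_[p] O) hdvd

theorem exists_aeval_eq_one_add_of_valuation_pow_sub_one_le
    (hζ : IsPrimitiveRoot ζ (p ^ (n + 2))) {g : ℤ_[p][X]}
    (h : v (aeval (ζ - 1) g ^ p - 1) ≤ v p) :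
    ∃ k r : ℤ_[p][X], aeval (ζ - 1) g =
      1 + ((ζ - 1) ^ ((p - 1) * p ^ n) * aeval (ζ - 1) k + p * aeval (ζ - 1) r) := by
  have hpow : v ((aeval (ζ - 1) g - 1) ^ p) ≤ v p := by
    have hsub := natCast_dvd_sub_one_pow_sub (p := p) (aeval (ζ - 1) g) 1
    rw [pow_one] at hsub
    simpa using v.map_sub_le h (valuation_le_of_dvd hv hsub)
  have hdvd : X ^ (p ^ (n + 1) * (p - 1)) ∣ ((g - 1) ^ p).map PadicInt.toZMod := by
    refine X_pow_dvd_map_toZMod hv hvp0 hvp hζ le_rfl ?_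
    simpa [valuation_sub_one_pow hv hζ] using hpow
  rw [Polynomial.map_pow, show p ^ (n + 1) * (p - 1) = (p - 1) * p ^ n * p by ring, pow_mul,
    UniqueFactorizationMonoid.pow_dvd_pow_iff_dvd hp.out.ne_zero] at hdvd
  obtain ⟨k, r, hkr⟩ := exists_eq_X_pow_mul_add hdvd
  refine ⟨k, r, ?_⟩
  rw [← sub_add_cancel g 1, hkr]
  simp [add_comm]

theorem valuation_lt_aeval_pow_sub_one_sub (hp2 : p ≠ 2) (hζ : IsPrimitiveRoot ζ (p ^ (n + 2)))
    (g : ℤ_[p][X]) :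
    v (p * (ζ - 1) ^ p ^ (n + 1)) < v (aeval (ζ - 1) g ^ p - (1 - p)) := by
  by_contra! h
  have hp3 : 3 ≤ p := hp.out.two_le.lt_of_ne' hp2
  have hone : v (aeval (ζ - 1) g ^ p - 1) ≤ v p := by
    simpa [← sub_add] using
      v.map_sub_le (h.trans (valuation_le_of_dvd hv (dvd_mul_right _ _))) le_rfl
  obtain ⟨k, r, hkr⟩ := exists_aeval_eq_one_add_of_valuation_pow_sub_one_le hv hvp0 hvp hζ hone
  have hsq : (ζ - 1) ^ p ^ (n + 1) ∣ ((ζ - 1) ^ ((p - 1) * p ^ n)) ^ 2 := by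
    rw [← pow_mul]
    refine pow_dvd_pow _ ?_
    calc p ^ (n + 1) = p * p ^ n := pow_succ' p n
      _ ≤ (p - 1) * 2 * p ^ n := Nat.mul_le_mul_right _ (by omega)
      _ = (p - 1) * p ^ n * 2 := by ring
  have hpow : p * (ζ - 1) ^ p ^ (n + 1) ∣ ((ζ - 1) ^ ((p - 1) * p ^ n)) ^ p + p := by
    convert natCast_mul_dvd_sub_one_pow_add hp2 hζ using 2
    ring
  have key := v.map_sub_le (valuation_le_of_dvd hv (natCast_mul_dvd_one_add_pow_sub_add
    (sub_one_pow_prime_pow_dvd hζ) hsq hpow (aeval (ζ - 1) k) (aeval (ζ - 1) r))) h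
  rw [← hkr, add_sub_cancel_left, map_mul, map_mul,
    mul_le_mul_iff_right₀ (zero_lt_iff.mpr hvp0), map_pow] at key
  have hX := X_pow_dvd_map_toZMod (f := k ^ p - X ^ ((p - 1) * p ^ n) * k - 1) hv hvp0 hvp hζ
    (Nat.le_mul_of_pos_right _ (Nat.sub_pos_of_lt hp.out.one_lt)) (by simpa using key)
  exact not_X_pow_dvd_artinSchreier n (k.map PadicInt.toZMod) (by simpa using hX)

end Reduction

section ReductionTwo

open Polynomial

variable {O Γ₀ : Type*} [CommRing O] [IsDomain O] [Algebra ℤ_[2] O]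
  [LinearOrderedCommGroupWithZero Γ₀] {v : Valuation O Γ₀}

theorem valuation_lt_aeval_sq_sub (hv : ∀ x, v x ≤ 1) (hv20 : v 2 ≠ 0) (hv2 : v 2 < 1) {a : ℕ}
    {ζ : O} (hζ : IsPrimitiveRoot ζ (2 ^ (a + 4))) (g : ℤ_[2][X]) :
    v 4 < v (aeval (ζ - 1) g ^ 2 - (1 + 2 * ζ ^ 2 ^ (a + 1))) := by
  by_contra! h
  have h4 : (4 : O) = 2 * 2 := by norm_num
  have h24 : v 4 ≤ v 2 := valuation_le_of_dvd hv ⟨2, h4⟩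
  rw [← Nat.cast_ofNat (R := O) (n := 2)] at hv20 hv2
  have hone : v (aeval (ζ - 1) g ^ 2 - 1) ≤ v (2 : ℕ) := by
    rw [← sub_add_cancel (_ - 1) (2 * ζ ^ 2 ^ (a + 1)), sub_sub, Nat.cast_ofNat]
    exact v.map_add_le (h.trans h24) (valuation_le_of_dvd hv (dvd_mul_right _ _))
  obtain ⟨k, r, hkr⟩ := exists_aeval_eq_one_add_of_valuation_pow_sub_one_le hv hv20 hv2 hζ hone
  simp only [Nat.add_one_sub_one, one_mul, Nat.cast_ofNat] at hkr hv20
  have hroot : 4 ∣ 2 * (ζ ^ 2 ^ (a + 1) - 1 - (ζ - 1) ^ 2 ^ (a + 1)) := by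
    rw [h4]
    exact mul_dvd_mul_left 2 (by exact_mod_cast natCast_dvd_sub_one_pow_sub (p := 2) ζ (a + 1))
  have hsum := dvd_sub (four_dvd_one_add_sq_sub_add (ρ := (ζ - 1) ^ 2 ^ (a + 1))
    (four_dvd_sub_one_pow_sq_add hζ) (aeval (ζ - 1) k) (aeval (ζ - 1) r)) hroot
  have key : v (2 * ((1 + (ζ - 1) ^ 2 ^ (a + 2)) * aeval (ζ - 1) k ^ 2 +
      (ζ - 1) ^ 2 ^ (a + 2) * aeval (ζ - 1) k - 1 - (ζ - 1) ^ 2 ^ (a + 1))) ≤ v 4 := by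
    convert v.map_sub_le (valuation_le_of_dvd hv hsum) h using 2
    rw [hkr]
    ring
  rw [h4, map_mul, map_mul, mul_le_mul_iff_right₀ (zero_lt_iff.mpr hv20)] at key
  have hX := X_pow_dvd_map_toZMod (j := 2 ^ (a + 3))
    (f := (1 + X ^ 2 ^ (a + 2)) * k ^ 2 + X ^ 2 ^ (a + 2) * k - 1 - X ^ 2 ^ (a + 1))
    hv (by simpa using hv20) hv2 hζ (by simp) (by
      rw [← map_pow v (ζ - 1)]
      exact .trans (by simpa using key)
        (valuation_le_of_dvd hv (sub_one_pow_prime_pow_dvd hζ)))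
  exact not_X_pow_dvd_artinSchreier_two a (k.map PadicInt.toZMod) (by simpa using hX)

end ReductionTwo

/-! ### Rings generated by roots of unity of `p`-power order -/

section AdjoinMuPInfty

open Filter

variable {p : ℕ} {A K : Type*} [CommRing A] [Field K] [Algebra A K]

theorem mem_adjoinMuPInfty {ζ : K} {n : ℕ} (h : ζ ^ p ^ n = 1) : ζ ∈ adjoinMuPInfty p A K :=
  Algebra.subset_adjoin ⟨n, h⟩

theorem map_mem_adjoinMuPInfty {B L : Type*} [CommRing B] [Field L] [Algebra B L]
    (f : adjoinMuPInfty p ℤ K →+* L) (x : adjoinMuPInfty p ℤ K) :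
    f x ∈ adjoinMuPInfty p B L := by
  obtain ⟨x, hx⟩ := x
  induction hx using Algebra.adjoin_induction with
  | mem x hx =>
    obtain ⟨n, hn⟩ := hx
    have hx1 : (⟨x, mem_adjoinMuPInfty hn⟩ : adjoinMuPInfty p ℤ K) ^ p ^ n = 1 := Subtype.ext hn
    exact mem_adjoinMuPInfty (n := n) (by rw [← map_pow, hx1, map_one])
  | algebraMap a =>
    change f (algebraMap ℤ _ a) ∈ _
    rw [eq_intCast, map_intCast]
    exact intCast_mem _ a
  | add x y hx hy ihx ihy => exact (map_add f ⟨x, hx⟩ ⟨y, hy⟩).symm ▸ add_mem ihx ihy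
  | mul x y hx hy ihx ihy => exact (map_mul f ⟨x, hx⟩ ⟨y, hy⟩).symm ▸ mul_mem ihx ihy

variable [hp : Fact p.Prime]

theorem isIntegral_adjoinMuPInfty : Algebra.IsIntegral A (adjoinMuPInfty p A K) :=
  Algebra.IsIntegral.adjoin fun _ ⟨n, hn⟩ =>
    IsIntegral.of_pow (pow_pos hp.out.pos n) (hn ▸ isIntegral_one)

theorem valuation_adjoinMuPInfty_le_one {Γ₀ : Type*} [LinearOrderedCommGroupWithZero Γ₀]
    {v : Valuation K Γ₀} (hv : ∀ a : A, v (algebraMap A K a) ≤ 1) (x : adjoinMuPInfty p A K) :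
    v x ≤ 1 := by
  obtain ⟨x, hx⟩ := x
  induction hx using Algebra.adjoin_induction with
  | mem x hx =>
    obtain ⟨n, hn⟩ := hx
    refine (pow_le_one_iff (pow_ne_zero n hp.out.ne_zero)).mp ?_
    rw [← map_pow, hn, map_one]
  | algebraMap a => exact hv a
  | add _ _ _ _ ihx ihy => exact v.map_add_le ihx ihy
  | mul x y _ _ ihx ihy => exact (map_mul v x y).trans_le (mul_le_one' ihx ihy)

theorem eventually_mem_adjoin_sub_one (x : adjoinMuPInfty p A K) :
    ∀ᶠ n in atTop, ∀ ζ : adjoinMuPInfty p A K, IsPrimitiveRoot ζ (p ^ n) →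
      x ∈ Algebra.adjoin A {ζ - 1} := by
  obtain ⟨x, hx⟩ := x
  induction hx using Algebra.adjoin_induction with
  | mem x hx =>
    obtain ⟨m, hm⟩ := hx
    filter_upwards [eventually_ge_atTop m] with n hn ζ hζ
    have : NeZero (p ^ n) := ⟨pow_ne_zero n hp.out.ne_zero⟩
    obtain ⟨c, hc⟩ := pow_dvd_pow p hn
    obtain ⟨i, -, hi⟩ := hζ.eq_pow_of_pow_eq_one (ξ := ⟨x, mem_adjoinMuPInfty hm⟩)
      (Subtype.ext (by simp [hc, pow_mul, hm]))
    have hmem : ζ ∈ Algebra.adjoin A {ζ - 1} := by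
      simpa using add_mem (Algebra.self_mem_adjoin_singleton A (ζ - 1)) (one_mem _)
    exact hi ▸ pow_mem hmem i
  | algebraMap a =>
    refine .of_forall fun n ζ _ => ?_
    exact Subalgebra.algebraMap_mem (Algebra.adjoin A {ζ - 1}) a
  | add _ _ _ _ ihx ihy =>
    filter_upwards [ihx, ihy] with n hnx hny ζ hζ using add_mem (hnx ζ hζ) (hny ζ hζ)
  | mul _ _ _ _ ihx ihy =>
    filter_upwards [ihx, ihy] with n hnx hny ζ hζ using mul_mem (hnx ζ hζ) (hny ζ hζ)

open Polynomial in
theorem exists_forall_exists_aeval_sub_one_eq (x : adjoinMuPInfty p A K) (m : ℕ) :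
    ∃ n, ∀ ζ : adjoinMuPInfty p A K, IsPrimitiveRoot ζ (p ^ (n + m)) →
      ∃ g : A[X], aeval (ζ - 1) g = x := by
  obtain ⟨n, hn⟩ :=
    ((tendsto_add_atTop_nat m).eventually (eventually_mem_adjoin_sub_one x)).exists
  refine ⟨n, fun ζ hζ => ?_⟩
  rw [← AlgHom.mem_range, ← Algebra.adjoin_singleton_eq_range_aeval]
  exact hn ζ hζ

variable [IsAlgClosed K]

theorem exists_isPrimitiveRoot_adjoinMuPInfty [CharZero K] (n : ℕ) :
    ∃ ζ : adjoinMuPInfty p A K, IsPrimitiveRoot ζ (p ^ n) := by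
  have : NeZero (p ^ n) := ⟨pow_ne_zero n hp.out.ne_zero⟩
  obtain ⟨ζ, hζ⟩ := HasEnoughRootsOfUnity.exists_primitiveRoot K (p ^ n)
  exact ⟨⟨ζ, mem_adjoinMuPInfty hζ.pow_eq_one⟩,
    .of_map_of_injective (f := (adjoinMuPInfty p A K).val) hζ Subtype.val_injective⟩

theorem exists_pow_prime_pow_eq {η : adjoinMuPInfty p A K} {m : ℕ} (hη : η ^ p ^ m = 1) (n : ℕ) :
    ∃ ζ : adjoinMuPInfty p A K, ζ ^ p ^ n = η := by
  obtain ⟨ζ, hζ⟩ := IsAlgClosed.exists_pow_nat_eq (η : K) (pow_pos hp.out.pos n)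
  have hζ1 : ζ ^ p ^ (n + m) = 1 := by
    rw [pow_add, pow_mul, hζ]
    simpa using congrArg (adjoinMuPInfty p A K).val hη
  exact ⟨⟨ζ, mem_adjoinMuPInfty hζ1⟩, Subtype.ext hζ⟩

theorem pthPowerSurjectiveModP_adjoinMuPInfty (hA : PthPowerSurjectiveModP p A) :
    PthPowerSurjectiveModP p (adjoinMuPInfty p A K) := by
  rintro ⟨r, hr⟩
  induction hr using Algebra.adjoin_induction with
  | mem x hx =>
    obtain ⟨n, hn⟩ := hx
    obtain ⟨ζ, hζ⟩ := exists_pow_prime_pow_eq (η := ⟨x, mem_adjoinMuPInfty hn⟩) (A := A)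
      (Subtype.ext hn) 1
    exact ⟨ζ, by simp [← hζ]⟩
  | algebraMap a =>
    obtain ⟨s, hs⟩ := hA a
    refine ⟨algebraMap A _ s, ?_⟩
    change _ ∣ algebraMap A (adjoinMuPInfty p A K) a - _
    simpa using map_dvd (algebraMap A (adjoinMuPInfty p A K)) hs
  | add x y hx hy ihx ihy =>
    obtain ⟨s, hs⟩ := ihx
    obtain ⟨t, ht⟩ := ihy
    obtain ⟨c, hc⟩ := exists_add_pow_prime_eq hp.out s t
    refine ⟨s + t, ?_⟩
    convert dvd_sub (dvd_add hs ht) (dvd_mul_right (p : adjoinMuPInfty p A K) (s * t * c)) using 1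
    change (⟨x, hx⟩ + ⟨y, hy⟩ : adjoinMuPInfty p A K) - _ = _
    rw [hc]
    ring
  | mul x y hx hy ihx ihy =>
    obtain ⟨s, hs⟩ := ihx
    obtain ⟨t, ht⟩ := ihy
    refine ⟨s * t, ?_⟩
    convert dvd_add (hs.mul_right ⟨y, hy⟩) (ht.mul_left (s ^ p)) using 1
    change (⟨x, hx⟩ * ⟨y, hy⟩ : adjoinMuPInfty p A K) - _ = _
    ring

end AdjoinMuPInfty

/-! ### The ring `ℤ_p[μ_{p^∞}]` -/

section ZpMuPInfty

open Polynomial NNReal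

variable {p : ℕ} [hp : Fact p.Prime]

/-- The `p`-adic valuation of `ℤ_p[μ_{p^∞}]`, written multiplicatively and normalised so that `p`
has value `p⁻¹`. -/
noncomputable def zpMuPInftyValuation (p : ℕ) [Fact p.Prime] : Valuation (ZpMuPInfty p) ℝ≥0 :=
  (PadicAlgCl.valued p).v.comap (algebraMap (ZpMuPInfty p) (PadicAlgCl p))

theorem zpMuPInftyValuation_le_one (x : ZpMuPInfty p) : zpMuPInftyValuation p x ≤ 1 := by
  refine valuation_adjoinMuPInfty_le_one (v := (PadicAlgCl.valued p).v) (fun a => ?_) x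
  rw [← NNReal.coe_le_coe, PadicAlgCl.valuation_coe,
    IsScalarTower.algebraMap_apply ℤ_[p] ℚ_[p] (PadicAlgCl p), PadicAlgCl.norm_extends]
  exact PadicInt.norm_le_one a

theorem zpMuPInftyValuation_natCast : zpMuPInftyValuation p p = (p : ℝ≥0)⁻¹ := by
  simpa [zpMuPInftyValuation] using PadicAlgCl.valuation_p p

theorem zpMuPInftyValuation_natCast_ne_zero : zpMuPInftyValuation p p ≠ 0 := by
  simp [zpMuPInftyValuation_natCast, hp.out.ne_zero]

theorem zpMuPInftyValuation_natCast_lt_one : zpMuPInftyValuation p p < 1 := by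
  rw [zpMuPInftyValuation_natCast]
  exact inv_lt_one_of_one_lt₀ (Nat.one_lt_cast.mpr hp.out.one_lt)

theorem natCast_dvd_of_zpMuPInftyValuation_le {x : ZpMuPInfty p}
    (h : zpMuPInftyValuation p x ≤ zpMuPInftyValuation p p) : (p : ZpMuPInfty p) ∣ x := by
  obtain ⟨n, hn⟩ := exists_forall_exists_aeval_sub_one_eq x 1
  obtain ⟨ζ, hζ⟩ := exists_isPrimitiveRoot_adjoinMuPInfty (p := p) (A := ℤ_[p])
    (K := AlgebraicClosure ℚ_[p]) (n + 1)
  obtain ⟨g, rfl⟩ := hn ζ hζ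
  rw [← valuation_sub_one_pow zpMuPInftyValuation_le_one hζ] at h
  obtain ⟨k, r, rfl⟩ := exists_eq_X_pow_mul_add (X_pow_dvd_map_toZMod zpMuPInftyValuation_le_one
    zpMuPInftyValuation_natCast_ne_zero zpMuPInftyValuation_natCast_lt_one hζ le_rfl h)
  simp only [map_add, map_mul, map_pow, aeval_X, map_natCast]
  exact dvd_add ((associated_sub_one_pow hζ).dvd'.mul_right _) (dvd_mul_right _ _)

theorem natCast_pow_dvd_iff_zpMuPInftyValuation_le {x : ZpMuPInfty p} {k : ℕ} :
    (p : ZpMuPInfty p) ^ k ∣ x ↔ zpMuPInftyValuation p x ≤ zpMuPInftyValuation p p ^ k := by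
  refine ⟨fun h => map_pow (zpMuPInftyValuation p) _ k ▸
    valuation_le_of_dvd zpMuPInftyValuation_le_one h, fun h => ?_⟩
  induction k generalizing x with
  | zero => simp
  | succ k ih =>
    obtain ⟨y, rfl⟩ := natCast_dvd_of_zpMuPInftyValuation_le
      (h.trans (pow_le_of_le_one zero_le zpMuPInftyValuation_natCast_lt_one.le k.succ_ne_zero))
    rw [map_mul, pow_succ',
      mul_le_mul_iff_right₀ (zero_lt_iff.mpr zpMuPInftyValuation_natCast_ne_zero)] at h
    exact pow_succ' (p : ZpMuPInfty p) k ▸ mul_dvd_mul_left _ (ih h)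

theorem natCast_pow_dvd_or_of_dvd_mul {x y : ZpMuPInfty p} {k : ℕ}
    (h : (p : ZpMuPInfty p) ^ (k + k) ∣ x * y) :
    (p : ZpMuPInfty p) ^ k ∣ x ∨ (p : ZpMuPInfty p) ^ k ∣ y := by
  rw [natCast_pow_dvd_iff_zpMuPInftyValuation_le, map_mul, pow_add] at h
  rw [natCast_pow_dvd_iff_zpMuPInftyValuation_le, natCast_pow_dvd_iff_zpMuPInftyValuation_le]
  by_contra hlt
  rw [not_or, not_le, not_le] at hlt
  exact h.not_gt (mul_lt_mul'' hlt.1 hlt.2 zero_le zero_le)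

theorem not_isPthPowerModPIInfty_one_sub (hp2 : p ≠ 2) :
    ¬ IsPthPowerModPIInfty p (ZpMuPInfty p) (1 - p) := by
  rintro ⟨x, hx⟩
  obtain ⟨s, hs, hsx⟩ := mem_pIInfty.mp hx
  obtain ⟨n, hn⟩ := exists_forall_exists_aeval_sub_one_eq x 2
  obtain ⟨ζ, hζ⟩ := exists_isPrimitiveRoot_adjoinMuPInfty (p := p) (A := ℤ_[p])
    (K := AlgebraicClosure ℚ_[p]) (n + 2)
  obtain ⟨g, rfl⟩ := hn ζ hζ
  refine (valuation_lt_aeval_pow_sub_one_sub zpMuPInftyValuation_le_one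
    zpMuPInftyValuation_natCast_ne_zero zpMuPInftyValuation_natCast_lt_one hp2 hζ g).not_ge ?_
  have hsp := valuation_pow_le_of_mem_IInfty zpMuPInftyValuation_le_one
    zpMuPInftyValuation_natCast_ne_zero hs
  rw [← valuation_sub_one_pow zpMuPInftyValuation_le_one hζ, pow_mul] at hsp
  rw [← hsx, map_mul, map_mul, map_pow]
  gcongr
  exact le_of_pow_le_pow_left₀ (Nat.sub_pos_of_lt hp.out.one_lt).ne' zero_le hsp

end ZpMuPInfty

section ZpMuPInftyTwo

theorem isPrimitiveRoot_two_pow_succ {O : Type*} [CommRing O] [CharZero O] {ζ : O}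
    {n : ℕ} (h : ζ ^ 2 ^ n = -1) : IsPrimitiveRoot ζ (2 ^ (n + 1)) := by
  have hne : ζ ^ 2 ^ n ≠ 1 :=
    h ▸ Ring.neg_one_ne_one_of_char_ne_two (by simp [ringChar.eq_zero])
  have hone : ζ ^ 2 ^ (n + 1) = 1 := by rw [pow_succ, pow_mul, h, neg_one_sq]
  exact orderOf_eq_prime_pow hne hone ▸ IsPrimitiveRoot.orderOf ζ

theorem zpMuPInftyValuation_four_lt_sq_sub (x : ZpMuPInfty 2) {η : ZpMuPInfty 2}
    (hη : η ^ 4 = -1) : zpMuPInftyValuation 2 4 < zpMuPInftyValuation 2 (x ^ 2 - (1 + 2 * η)) := by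
  obtain ⟨n, hn⟩ := exists_forall_exists_aeval_sub_one_eq x 4
  obtain ⟨ζ, rfl⟩ := exists_pow_prime_pow_eq (η := η) (m := 3)
    (by rw [show 2 ^ 3 = 4 * 2 by norm_num, pow_mul, hη, neg_one_sq]) (n + 1)
  have hζ : IsPrimitiveRoot ζ (2 ^ (n + 4)) :=
    isPrimitiveRoot_two_pow_succ (by rw [← hη, ← pow_mul]; ring)
  obtain ⟨g, rfl⟩ := hn ζ hζ
  exact valuation_lt_aeval_sq_sub zpMuPInftyValuation_le_one
    zpMuPInftyValuation_natCast_ne_zero zpMuPInftyValuation_natCast_lt_one hζ g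

theorem not_isPthPowerModPIInfty_add_two_mul {i ζ : ZpMuPInfty 2} (hi : i ^ 2 = -1)
    (hζ : ζ ^ 4 = -1) : ¬ IsPthPowerModPIInfty 2 (ZpMuPInfty 2) (i + 2 * ζ) := by
  rintro ⟨x, hx⟩
  obtain ⟨s, hs, hsx⟩ := mem_pIInfty.mp hx
  obtain ⟨ω, hω⟩ := exists_pow_prime_pow_eq (η := i) (m := 2)
    (by rw [show 2 ^ 2 = 2 * 2 by norm_num, pow_mul, hi, neg_one_sq]) 1
  rw [pow_one] at hω
  -- Division by the square `i = ω ^ 2` turns `i + 2 * ζ` into `1 + 2 * η` with `η = -(i * ζ)`.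
  have hη : (-(i * ζ)) ^ 4 = -1 := by linear_combination i ^ 4 * hζ - (i ^ 2 - 1) * hi
  refine (zpMuPInftyValuation_four_lt_sq_sub (x * ω ^ 3) hη).not_ge ?_
  have hsx' : (x * ω ^ 3) ^ 2 - (1 + 2 * -(i * ζ)) = 2 * s * i ^ 3 := by
    push_cast at hsx
    linear_combination x ^ 2 * (ω ^ 4 + ω ^ 2 * i + i ^ 2) * hω - i ^ 3 * hsx +
      (i ^ 2 + 2 * i * ζ - 1) * hi
  have hs2 := valuation_pow_le_of_mem_IInfty zpMuPInftyValuation_le_one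
    zpMuPInftyValuation_natCast_ne_zero hs
  rw [Nat.add_one_sub_one, pow_one, Nat.cast_ofNat] at hs2
  rw [hsx', show (4 : ZpMuPInfty 2) = 2 * 2 by norm_num, map_mul, map_mul, map_mul]
  exact (mul_le_of_le_one_right' (zpMuPInftyValuation_le_one _)).trans (by gcongr)

end ZpMuPInftyTwo

/-! ### Completion at a principal ideal -/

section Completion

variable {A : Type*} [CommRing A] {c : A}

theorem exists_pow_dvd_sub_algebraMap (k : ℕ) (b : AdicCompletion (Ideal.span {c}) A) :
    ∃ a, algebraMap A _ c ^ k ∣ b - algebraMap A _ a := by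
  obtain ⟨a, ha⟩ := Ideal.Quotient.mk_surjective (AdicCompletion.evalₐ (Ideal.span {c}) k b)
  have hker : b - algebraMap A _ a ∈
      (Ideal.span {c} ^ k • ⊤ : Submodule A (AdicCompletion (Ideal.span {c}) A)) := by
    rw [AdicCompletion.pow_smul_top_eq_ker_eval (Submodule.fg_span_singleton c),
      LinearMap.mem_ker, ← AdicCompletion.factor_evalₐ_eq_eval _ _ (by simp), map_sub,
      AlgHom.commutes, ← ha, Ideal.Quotient.algebraMap_eq, sub_self, map_zero]
  rw [Ideal.span_singleton_pow, Submodule.ideal_span_singleton_smul,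
    Submodule.mem_smul_pointwise_iff_exists] at hker
  obtain ⟨b', -, hb'⟩ := hker
  exact ⟨a, b', by rw [← map_pow, ← Algebra.smul_def, hb']⟩

theorem evalₐ_eq_zero_of_pow_dvd {k : ℕ} {b : AdicCompletion (Ideal.span {c}) A}
    (h : algebraMap A _ c ^ k ∣ b) : AdicCompletion.evalₐ (Ideal.span {c}) k b = 0 := by
  obtain ⟨b', rfl⟩ := h
  rw [← map_pow, map_mul, AlgHom.commutes, Ideal.Quotient.algebraMap_eq,
    Ideal.Quotient.eq_zero_iff_mem.mpr (Ideal.pow_mem_pow (Ideal.mem_span_singleton_self c) k),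
    zero_mul]

theorem pow_dvd_algebraMap_iff {k : ℕ} {a : A} :
    algebraMap A (AdicCompletion (Ideal.span {c}) A) c ^ k ∣ algebraMap A _ a ↔ c ^ k ∣ a := by
  refine ⟨fun h => ?_, fun h => by rw [← map_pow]; exact map_dvd _ h⟩
  have heval := evalₐ_eq_zero_of_pow_dvd h
  rwa [AlgHom.commutes, Ideal.Quotient.algebraMap_eq, Ideal.Quotient.eq_zero_iff_mem,
    Ideal.span_singleton_pow, Ideal.mem_span_singleton] at heval

theorem eq_zero_of_forall_pow_dvd {b : AdicCompletion (Ideal.span {c}) A}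
    (h : ∀ k, algebraMap A _ c ^ k ∣ b) : b = 0 :=
  AdicCompletion.ext_evalₐ fun k => by rw [evalₐ_eq_zero_of_pow_dvd (h k), map_zero]

theorem algebraMap_adicCompletion_injective (h : ∀ a : A, (∀ k, c ^ k ∣ a) → a = 0) :
    Function.Injective (algebraMap A (AdicCompletion (Ideal.span {c}) A)) :=
  (injective_iff_map_eq_zero _).mpr fun a ha =>
    h a fun _ => pow_dvd_algebraMap_iff.mp (ha ▸ dvd_zero _)

theorem noZeroDivisors_adicCompletion
    (h : ∀ (x y : A) (k : ℕ), c ^ (k + k) ∣ x * y → c ^ k ∣ x ∨ c ^ k ∣ y) :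
    NoZeroDivisors (AdicCompletion (Ideal.span {c}) A) := by
  refine ⟨fun {x y} hxy => ?_⟩
  by_contra! hne
  obtain ⟨k, hk⟩ := not_forall.mp fun hx => hne.1 (eq_zero_of_forall_pow_dvd hx)
  obtain ⟨l, hl⟩ := not_forall.mp fun hy => hne.2 (eq_zero_of_forall_pow_dvd hy)
  obtain ⟨a, ha⟩ := exists_pow_dvd_sub_algebraMap (max k l + max k l) x
  obtain ⟨b, hb⟩ := exists_pow_dvd_sub_algebraMap (max k l + max k l) y
  have hab : c ^ (max k l + max k l) ∣ a * b := by
    rw [← pow_dvd_algebraMap_iff, map_mul, ← dvd_neg]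
    convert dvd_add (ha.mul_right y) (hb.mul_left (algebraMap A _ a)) using 1
    linear_combination -hxy
  have hmax := Nat.le_add_left (max k l) (max k l)
  rcases h a b _ hab with hdvd | hdvd
  · refine hk ((pow_dvd_pow _ (le_max_left k l)).trans ?_)
    rw [← sub_add_cancel x (algebraMap A _ a)]
    exact dvd_add ((pow_dvd_pow _ hmax).trans ha) (pow_dvd_algebraMap_iff.mpr hdvd)
  · refine hl ((pow_dvd_pow _ (le_max_right k l)).trans ?_)
    rw [← sub_add_cancel y (algebraMap A _ b)]
    exact dvd_add ((pow_dvd_pow _ hmax).trans hb) (pow_dvd_algebraMap_iff.mpr hdvd)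

end Completion

section ZpMuPInftyCompletion

variable {p : ℕ} [hp : Fact p.Prime]

theorem algebraMap_zpMuPInftyCompletion_injective :
    Function.Injective (algebraMap (ZpMuPInfty p) (ZpMuPInftyCompletion p)) := by
  refine algebraMap_adicCompletion_injective fun x hx => ?_
  by_contra hne
  have hpos : 0 < zpMuPInftyValuation p x :=
    zero_lt_iff.mpr ((PadicAlgCl.valued p).v.ne_zero_iff.mpr (Subtype.coe_ne_coe.mpr hne))
  obtain ⟨k, hk⟩ := exists_pow_lt_of_lt_one hpos (zpMuPInftyValuation_natCast_lt_one (p := p))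
  exact hk.not_ge (natCast_pow_dvd_iff_zpMuPInftyValuation_le.mp (hx k))

instance isDomain_zpMuPInftyCompletion : IsDomain (ZpMuPInftyCompletion p) :=
  have := noZeroDivisors_adicCompletion (c := (p : ZpMuPInfty p))
    fun _ _ _ => natCast_pow_dvd_or_of_dvd_mul
  have := (algebraMap_zpMuPInftyCompletion_injective (p := p)).nontrivial
  NoZeroDivisors.to_isDomain _

instance charZero_zpMuPInftyCompletion : CharZero (ZpMuPInftyCompletion p) :=
  charZero_of_injective_algebraMap algebraMap_zpMuPInftyCompletion_injective

theorem exists_natCast_dvd_sub_algebraMap (b : ZpMuPInftyCompletion p) :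
    ∃ a : ZpMuPInfty p, (p : ZpMuPInftyCompletion p) ∣ b - algebraMap _ _ a := by
  simpa using exists_pow_dvd_sub_algebraMap 1 b

theorem natCast_dvd_of_natCast_dvd_algebraMap {a : ZpMuPInfty p}
    (h : (p : ZpMuPInftyCompletion p) ∣ algebraMap _ _ a) : (p : ZpMuPInfty p) ∣ a := by
  rw [← pow_one (p : ZpMuPInfty p), ← pow_dvd_algebraMap_iff]
  simpa using h

theorem IsPthPowerModPIInfty.of_algebraMap_zpMuPInftyCompletion {c : ZpMuPInfty p}
    (h : IsPthPowerModPIInfty p (ZpMuPInftyCompletion p) (algebraMap _ _ c)) :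
    IsPthPowerModPIInfty p (ZpMuPInfty p) c :=
  h.of_map (IsLeftCancelMulZero.mul_left_cancel_of_ne_zero (Nat.cast_ne_zero.mpr hp.out.ne_zero))
    (fun _ => natCast_dvd_of_natCast_dvd_algebraMap) exists_natCast_dvd_sub_algebraMap

theorem exists_isPrimitiveRoot_zpMuPInftyCompletion (n : ℕ) :
    ∃ ζ : ZpMuPInftyCompletion p, IsPrimitiveRoot ζ (p ^ n) := by
  obtain ⟨ζ, hζ⟩ := exists_isPrimitiveRoot_adjoinMuPInfty (p := p) (A := ℤ_[p])
    (K := AlgebraicClosure ℚ_[p]) n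
  exact ⟨_, hζ.map_of_injective algebraMap_zpMuPInftyCompletion_injective⟩

theorem exists_algebraMap_eq_of_pow_prime_pow_eq_one {x : ZpMuPInftyCompletion p} {n : ℕ}
    (hx : x ^ p ^ n = 1) : ∃ y : ZpMuPInfty p, algebraMap _ _ y = x := by
  obtain ⟨ζ, hζ⟩ := exists_isPrimitiveRoot_adjoinMuPInfty (p := p) (A := ℤ_[p])
    (K := AlgebraicClosure ℚ_[p]) n
  have : NeZero (p ^ n) := ⟨pow_ne_zero n hp.out.ne_zero⟩
  obtain ⟨i, -, rfl⟩ :=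
    (hζ.map_of_injective algebraMap_zpMuPInftyCompletion_injective).eq_pow_of_pow_eq_one hx
  exact ⟨ζ ^ i, map_pow _ _ _⟩

end ZpMuPInftyCompletion

/-! ### The three rings -/

section PthPowerObstruction

variable {p : ℕ} [hp : Fact p.Prime]

variable (p) in
/-- The elements `1 - p` (for odd `p`) and `i + 2ζ` (for `p = 2`, with `i` and `ζ` primitive
fourth and eighth roots of unity) are not `p`-th powers in `R / p I_∞`. The roots of unity are
given by the equations `i ^ 2 = -1` and `ζ ^ 4 = -1`, which every ring homomorphism preserves. -/
structure PthPowerObstruction (R : Type*) [CommRing R] : Prop where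
  one_sub : p ≠ 2 → ¬ IsPthPowerModPIInfty p R (1 - p)
  add_two_mul : p = 2 → ∀ i ζ : R, i ^ 2 = -1 → ζ ^ 4 = -1 →
    ¬ IsPthPowerModPIInfty p R (i + 2 * ζ)

variable {R S : Type*} [CommRing R] [CommRing S]

theorem PthPowerObstruction.comap (h : PthPowerObstruction p S) (f : R →+* S) :
    PthPowerObstruction p R where
  one_sub hp2 hx := h.one_sub hp2 (by simpa using hx.map f)
  add_two_mul hp2 i ζ hi hζ hx :=
    h.add_two_mul hp2 (f i) (f ζ) (by rw [← map_pow, hi, map_neg, map_one])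
      (by rw [← map_pow, hζ, map_neg, map_one])
      (by simpa only [map_add, map_mul, map_ofNat] using hx.map f)

theorem PthPowerObstruction.exists_not_isPthPowerModPIInfty [IsDomain R]
    (h : PthPowerObstruction p R) (hζ : ∀ n, ∃ ζ : R, IsPrimitiveRoot ζ (p ^ n)) :
    ∃ r : R, ¬ IsPthPowerModPIInfty p R r := by
  by_cases hp2 : p = 2
  · subst hp2
    obtain ⟨ζ, hζ⟩ := hζ 3
    exact ⟨_, h.add_two_mul rfl _ ζ (sq_pow_eq_neg_one_of_isPrimitiveRoot (n := 1) hζ)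
      (by rw [← sq_pow_eq_neg_one_of_isPrimitiveRoot (n := 1) hζ]; ring)⟩
  · exact ⟨_, h.one_sub hp2⟩

theorem PthPowerSurjectiveModP.frobenius_and_pthPower [IsDomain R] [CharZero R]
    (hζ : ∀ n, ∃ ζ : R, IsPrimitiveRoot ζ (p ^ n)) (hR : PthPowerSurjectiveModP p R)
    (h : PthPowerObstruction p R) :
    FrobeniusSurjectiveFiniteLevels p R ∧ ¬ TeichmullerInFrobeniusImage p R ∧
      ¬ PthPowerSurjectiveModPIInfty p R ∧
      (p ≠ 2 → ¬ ∃ x : R, x ^ p - (1 - (p : R)) ∈ pIInfty p R) ∧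
      (p = 2 → ∀ i ζ : R, IsPrimitiveRoot i 4 → IsPrimitiveRoot ζ 8 →
        ¬ ∃ x : R, x ^ 2 - (i + 2 * ζ) ∈ pIInfty p R) := by
  obtain ⟨r, hr⟩ := h.exists_not_isPthPowerModPIInfty hζ
  refine ⟨fun n _ => truncatedFrobenius_surjective hζ hR n,
    fun hT => hr (hT.isPthPowerModPIInfty r), fun hS => hr (hS.isPthPowerModPIInfty r),
    h.one_sub, ?_⟩
  rintro rfl i ζ hi hζ
  refine h.add_two_mul rfl i ζ ?_ ?_
  · simpa using sq_pow_eq_neg_one_of_isPrimitiveRoot (n := 0) hi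
  · rw [← sq_pow_eq_neg_one_of_isPrimitiveRoot (n := 1) hζ]
    ring

end PthPowerObstruction

section Rings

variable (p : ℕ) [hp : Fact p.Prime]

theorem pthPowerSurjectiveModP_int : PthPowerSurjectiveModP p ℤ := fun r =>
  ⟨r, (ZMod.intCast_zmod_eq_zero_iff_dvd _ p).mp (by simp)⟩

theorem pthPowerSurjectiveModP_padicInt : PthPowerSurjectiveModP p ℤ_[p] :=
  (pthPowerSurjectiveModP_int p).of_forall_exists_dvd_sub_map (f := Int.castRingHom ℤ_[p])
    fun b => ⟨b.appr 1, by simpa [Ideal.mem_span_singleton] using PadicInt.appr_spec 1 b⟩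

theorem pthPowerSurjectiveModP_zpMuPInftyCompletion :
    PthPowerSurjectiveModP p (ZpMuPInftyCompletion p) :=
  (pthPowerSurjectiveModP_adjoinMuPInfty
    (pthPowerSurjectiveModP_padicInt p)).of_forall_exists_dvd_sub_map
      exists_natCast_dvd_sub_algebraMap

theorem nonempty_ringHom_zMuPInfty_zpMuPInfty : Nonempty (ZMuPInfty p →+* ZpMuPInfty p) := by
  have : Algebra.IsIntegral ℤ (ZMuPInfty p) := isIntegral_adjoinMuPInfty
  let f : ZMuPInfty p →ₐ[ℤ] AlgebraicClosure ℚ_[p] := IsAlgClosed.lift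
  exact ⟨f.toRingHom.codRestrict _ (map_mem_adjoinMuPInfty f.toRingHom)⟩

theorem pthPowerObstruction_zpMuPInfty : PthPowerObstruction p (ZpMuPInfty p) where
  one_sub := not_isPthPowerModPIInfty_one_sub
  add_two_mul := by
    rintro rfl i ζ hi hζ
    exact not_isPthPowerModPIInfty_add_two_mul hi hζ

theorem pthPowerObstruction_zpMuPInftyCompletion :
    PthPowerObstruction p (ZpMuPInftyCompletion p) where
  one_sub hp2 hx := not_isPthPowerModPIInfty_one_sub hp2
    (.of_algebraMap_zpMuPInftyCompletion (by simpa using hx))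
  add_two_mul := by
    rintro rfl i ζ hi hζ hx
    obtain ⟨i, rfl⟩ := exists_algebraMap_eq_of_pow_prime_pow_eq_one (p := 2) (n := 2)
      (show i ^ (2 * 2) = 1 by rw [pow_mul, hi, neg_one_sq])
    obtain ⟨ζ, rfl⟩ := exists_algebraMap_eq_of_pow_prime_pow_eq_one (p := 2) (n := 3)
      (show ζ ^ (4 * 2) = 1 by rw [pow_mul, hζ, neg_one_sq])
    have hinj := algebraMap_zpMuPInftyCompletion_injective (p := 2)
    exact not_isPthPowerModPIInfty_add_two_mul (hinj (by simpa using hi))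
      (hinj (by simpa using hζ))
      (.of_algebraMap_zpMuPInftyCompletion (hp := hp)
        (by simpa only [map_add, map_mul, map_ofNat] using hx))

end Rings

theorem mainTheorem8 (p : ℕ) [hp : Fact p.Prime] :
    -- the ring `ℤ[μ_{p^∞}]`
    (FrobeniusSurjectiveFiniteLevels p (ZMuPInfty p) ∧
      ¬ TeichmullerInFrobeniusImage p (ZMuPInfty p) ∧
      ¬ PthPowerSurjectiveModPIInfty p (ZMuPInfty p) ∧
      (p ≠ 2 → ¬ ∃ x : ZMuPInfty p,
        x ^ p - (1 - (p : ZMuPInfty p)) ∈ pIInfty p (ZMuPInfty p)) ∧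
      (p = 2 → ∀ i ζ : ZMuPInfty p, IsPrimitiveRoot i 4 → IsPrimitiveRoot ζ 8 →
        ¬ ∃ x : ZMuPInfty p, x ^ 2 - (i + 2 * ζ) ∈ pIInfty p (ZMuPInfty p))) ∧
    -- the ring `ℤ_p[μ_{p^∞}]`
    (FrobeniusSurjectiveFiniteLevels p (ZpMuPInfty p) ∧
      ¬ TeichmullerInFrobeniusImage p (ZpMuPInfty p) ∧
      ¬ PthPowerSurjectiveModPIInfty p (ZpMuPInfty p) ∧
      (p ≠ 2 → ¬ ∃ x : ZpMuPInfty p,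
        x ^ p - (1 - (p : ZpMuPInfty p)) ∈ pIInfty p (ZpMuPInfty p)) ∧
      (p = 2 → ∀ i ζ : ZpMuPInfty p, IsPrimitiveRoot i 4 → IsPrimitiveRoot ζ 8 →
        ¬ ∃ x : ZpMuPInfty p, x ^ 2 - (i + 2 * ζ) ∈ pIInfty p (ZpMuPInfty p))) ∧
    -- the `p`-adic completion of `ℤ_p[μ_{p^∞}]`
    (FrobeniusSurjectiveFiniteLevels p (ZpMuPInftyCompletion p) ∧
      ¬ TeichmullerInFrobeniusImage p (ZpMuPInftyCompletion p) ∧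
      ¬ PthPowerSurjectiveModPIInfty p (ZpMuPInftyCompletion p) ∧
      (p ≠ 2 → ¬ ∃ x : ZpMuPInftyCompletion p,
        x ^ p - (1 - (p : ZpMuPInftyCompletion p)) ∈ pIInfty p (ZpMuPInftyCompletion p)) ∧
      (p = 2 → ∀ i ζ : ZpMuPInftyCompletion p, IsPrimitiveRoot i 4 → IsPrimitiveRoot ζ 8 →
        ¬ ∃ x : ZpMuPInftyCompletion p,
          x ^ 2 - (i + 2 * ζ) ∈ pIInfty p (ZpMuPInftyCompletion p))) := by
  obtain ⟨f⟩ := nonempty_ringHom_zMuPInfty_zpMuPInfty p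
  have hZp := pthPowerObstruction_zpMuPInfty p
  exact ⟨PthPowerSurjectiveModP.frobenius_and_pthPower exists_isPrimitiveRoot_adjoinMuPInfty
      (pthPowerSurjectiveModP_adjoinMuPInfty (pthPowerSurjectiveModP_int p)) (hZp.comap f),
    PthPowerSurjectiveModP.frobenius_and_pthPower exists_isPrimitiveRoot_adjoinMuPInfty
      (pthPowerSurjectiveModP_adjoinMuPInfty (pthPowerSurjectiveModP_padicInt p)) hZp,
    PthPowerSurjectiveModP.frobenius_and_pthPower exists_isPrimitiveRoot_zpMuPInftyCompletion
      (pthPowerSurjectiveModP_zpMuPInftyCompletion p)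
      (pthPowerObstruction_zpMuPInftyCompletion p)⟩
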